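/- **Setting.** Fix $T>0$ and a filtered probability space $(\Omega,\mathcal F,(\mathcal F_t)_{t\in[0,T]},\mathbb P)$ (the usual conditions are not assumed), and write $\mathbb E_s=\mathbb E[\,\cdot\,|\mathcal F_s]$ and $\delta Y_{s,t}=Y_t-Y_s$. Processes take values in finite-dimensional Banach spaces. For a two-parameter function $f\ge 0$ on $\{0\le s\le t\le T\}$ put $V_p(f)=\big(\sup_{\mathcal P}\sum_{[u,v]\in\mathcal P} f(u,v)^p\big)^{1/p}$, the supremum being over all partitions $\mathcal P$ of $[0,T]$. Put $\|Y\|_{q,r,s}=\big\|\mathbb E_s[|Y|^q]\big\|_{L^r}^{1/q}$. A process $Y$ belongs to $V^pL^q$ (resp. $V^pL^{q,r}$) if it is right-continuous in probability, $Y_0\in L^q$, and $V_p\big((u,v)\mapsto\|\delta Y_{u,v}\|_{L^q}\big)<\infty$ (resp. $V_p\big((u,v)\mapsto\|\delta Y_{u,v}\|_{q,r,u}\big)<\infty$). For such a process, $Y_{t-}=\lim_{s\nearrow t}Y_s$ and $\Delta Y_t=Y_t-Y_{t-}$, $t\in(0,T]$, are understood as limits in $L^q$. A càdlàg rough path $\mathbf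 X=(X,\mathbb X)\in\mathscr V^p([0,T];\mathbb R^d)$ consists of a càdlàg path $X$ in $\mathbb R^d$ of finite $p$-variation and a càdlàg two-parameter function $\mathbb X$ in $\mathbb R^{d\times d}$ of finite $\frac p2$-variation such that $\mathbb X_{s,t}=\mathbb X_{s,u}+\mathbb X_{u,t}+\delta X_{s,u}\otimes\delta X_{u,t}$ for $s\le u\le t$. A pair $(Y,Y')$ of adapted processes is a stochastic controlled path, $(Y,Y')\in\mathcal V^{p,q,r}_X$, if $Y,Y'\in V^pL^{q,r}$, $\sup_s\|Y'_s\|_{L^{qr}}<\infty$, and $V_{p/2}\big((u,v)\mapsto\|\mathbb E_u[R^Y_{u,v}]\|_{L^{qr}}\big)<\infty$, where $R^Y_{s,t}=\delta Y_{s,t}-Y'_s\,\delta X_{s,t}$. The bracket $[Y,Z]$ of $(Y,Y'),(Z,Z')\in\mathcal V^{p,q,r}_X$ is the (up to modification unique) adapted process in $V^{p/2}L^{q/2}$ such that, for every $t\in[0,T]$, $$[Y,Z]_t=\lim_{|\mathcal P|\to0}\ \sum_{[u,v]\in\mathcal P}\Big(\delta Y_{u,v}\otimes\delta Z_{u,v}-2\,(Y'_u\otimes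 Z'_u)\,\mathrm{Sym}(\mathbb X_{u,v})\Big)\quad\text{in }L^{q/2},$$ along partitions $\mathcal P$ of $[0,t]$ as the mesh size tends to zero. **Lemma.** Let $p\in[2,3)$, $q\in[4,\infty)$, $r\in[1,\infty]$, and let $\mathbf X=(X,\mathbb X)\in\mathscr V^p$ be a càdlàg rough path. Let $M\in V^pL^{q,r}$ be a martingale with almost surely càdlàg sample paths, and let $(Z,Z')\in\mathcal V^{p,q,r}_X$ be a stochastic controlled path such that $R^Z\in V^{p/2}L^q$, i.e. $V_{p/2}\big((u,v)\mapsto\|R^Z_{u,v}\|_{L^q}\big)<\infty$. Then the left limits $M_{s-}$ and $Z_{s-}$ exist in $L^q$ for every $s\in(0,T]$, the bracket $[M,Z]$ of $(M,0)$ and $(Z,Z')$ exists, and, for each $t\in[0,T]$, $$[M,Z]_t=\sum_{0<s\le t}\Delta M_s\otimes\Delta Z_s,$$ where the sum is over all (deterministic) times $s\in(0,t]$ such that $\|\Delta M_s\otimes\Delta Z_s\|_{L^{q/2}}\ne0$, and converges unconditionally in $L^{q/2}$. -/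

import Mathlib

open MeasureTheory ProbabilityTheory Filter Topology
open scoped ENNReal TensorProduct

noncomputable section

namespace RoughStoch

/-- The time interval `[0,T]`, as a type. -/
abbrev Time (T : ℝ) : Type := Set.Icc (0 : ℝ) T

/-- The initial time `0 ∈ [0,T]`. -/
def zeroTime {T : ℝ} (hT : 0 < T) : Time T := ⟨0, le_refl 0, hT.le⟩

/-! ### Partitions and `p`-variation -/

/-- A partition `{s = t₀ < t₁ < ⋯ < tₙ = t}` of `[s,t]`. -/
structure Partition {T : ℝ} (s t : Time T) where
  /-- the number of intervals -/
  n : ℕ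
  /-- the partition points -/
  pt : Fin (n + 1) → Time T
  strictMono : StrictMono pt
  first : pt 0 = s
  last : pt (Fin.last n) = t

namespace Partition

variable {T : ℝ} {s t : Time T}

/-- `∑_{[u,v] ∈ π} F u v`, the sum over all pairs of consecutive points of the partition. -/
def sum {A : Type*} [AddCommMonoid A] (π : Partition s t) (F : Time T → Time T → A) : A :=
  ∑ i : Fin π.n, F (π.pt i.castSucc) (π.pt i.succ)

/-- The mesh size of the partition is smaller than `η`. -/
def MeshLT (π : Partition s t) (η : ℝ) : Prop :=
  ∀ i : Fin π.n, (π.pt i.succ : ℝ) - (π.pt i.castSucc : ℝ) < η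

end Partition

/-- `(sup_{π ⊂ [s,t]} ∑_{[u,v] ∈ π} (f u v) ^ p) ^ (1/p)` for a `[0,∞]`-valued two-parameter
function `f`. The various variation norms are obtained by taking for `f u v` the appropriate norm
of the value at `(u,v)` of a two-parameter function or process. -/
def pVar {T : ℝ} (p : ℝ) (f : Time T → Time T → ℝ≥0∞) (s t : Time T) : ℝ≥0∞ :=
  (⨆ π : Partition s t, π.sum (fun u v => f u v ^ p)) ^ (1 / p)

/-- `pVar` over the whole of `[0,T]`. -/
def pVarTotal {T : ℝ} (hT : 0 < T) (p : ℝ) (f : Time T → Time T → ℝ≥0∞) : ℝ≥0∞ :=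
  pVar p f (zeroTime hT) ⟨T, hT.le, le_refl T⟩

/-- A path on `[0,T]` is càdlàg: right-continuous with left limits. -/
def IsCadlag {T : ℝ} {A : Type*} [TopologicalSpace A] (f : Time T → A) : Prop :=
  ∀ t, ContinuousWithinAt f (Set.Ici t) t ∧ ∃ l, Tendsto f (𝓝[<] t) (𝓝 l)

/-! ### Deterministic paths and càdlàg rough paths -/

/-- `X ∈ V^p([0,T]; A)`: a càdlàg path of finite `p`-variation. -/
structure MemV {T : ℝ} {A : Type*} [NormedAddCommGroup A] (hT : 0 < T) (p : ℝ)
    (X : Time T → A) : Prop where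
  cadlag : IsCadlag X
  finite : pVarTotal hT p (fun u v => ‖X v - X u‖ₑ) < ∞

/-- `(X, 𝕏)` is a càdlàg `p`-rough path over `ℝ^d`. Here `ℝ^{d × d}` is `ℝ^d ⊗ ℝ^d`, with its
Euclidean (Frobenius) norm; only the values `𝕏 s t` with `s ≤ t` play a role. -/
structure IsCadlagRoughPath {T : ℝ} {d : ℕ} (hT : 0 < T) (p : ℝ)
    (X : Time T → EuclideanSpace ℝ (Fin d))
    (XX : Time T → Time T → EuclideanSpace ℝ (Fin d) ⊗[ℝ] EuclideanSpace ℝ (Fin d)) : Prop where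
  memV : MemV hT p X
  right_cont_snd : ∀ s t, s ≤ t → ContinuousWithinAt (fun v => XX s v) (Set.Ici t) t
  left_lim_snd : ∀ s t, s < t → ∃ l, Tendsto (fun v => XX s v) (𝓝[<] t) (𝓝 l)
  right_cont_fst : ∀ s t, s < t → ContinuousWithinAt (fun u => XX u t) (Set.Ici s) s
  left_lim_fst : ∀ s t, s ≤ t → ∃ l, Tendsto (fun u => XX u t) (𝓝[<] s) (𝓝 l)
  finite : pVarTotal hT (p / 2) (fun u v => ‖XX u v‖ₑ) < ∞
  chen : ∀ s u t, s ≤ u → u ≤ t →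
    XX s t = XX s u + XX u t + (X u - X s) ⊗ₜ[ℝ] (X t - X u)

/-- The symmetric part `(x + xᵀ) / 2` of a two-tensor. -/
def symPart {V : Type*} [AddCommGroup V] [Module ℝ V] (x : V ⊗[ℝ] V) : V ⊗[ℝ] V :=
  (1 / 2 : ℝ) • (x + TensorProduct.comm ℝ V V x)

/-! ### Spaces of stochastic processes -/

section Processes

variable {Ω : Type*} {mΩ : MeasurableSpace Ω} {T : ℝ} {A : Type*} [NormedAddCommGroup A]

/-- `‖Y‖_{q,r,s} = ‖𝔼[|Y|^q | ℱ_s]‖_{L^r}^{1/q}`, with the `[0,∞]`-valued conditional expectation. -/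
def condNorm (P : Measure Ω) (ℱ : Filtration (Time T) mΩ) (q : ℝ) (r : ℝ≥0∞) (s : Time T)
    (Y : Ω → A) : ℝ≥0∞ :=
  eLpNorm (P⁻[fun ω => ‖Y ω‖ₑ ^ q | ℱ s]) r P ^ (1 / q)

/-- `Y_t → Y_s` in probability as `t ↘ s`, for every `s`. -/
def RightContInProb (P : Measure Ω) (Y : Time T → Ω → A) : Prop :=
  ∀ s, TendstoInMeasure P Y (𝓝[>] s) (Y s)

/-- `Y ∈ V^p L^q`. -/
structure MemVL (hT : 0 < T) (P : Measure Ω) (p q : ℝ) (Y : Time T → Ω → A) : Prop where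
  measurable : ∀ t, StronglyMeasurable (Y t)
  right_cont : RightContInProb P Y
  memLp_zero : MemLp (Y (zeroTime hT)) (ENNReal.ofReal q) P
  finite : pVarTotal hT p
    (fun u v => eLpNorm (fun ω => Y v ω - Y u ω) (ENNReal.ofReal q) P) < ∞

/-- `Y ∈ V^p L^{q,r}`. -/
structure MemVLr (hT : 0 < T) (P : Measure Ω) (ℱ : Filtration (Time T) mΩ) (p q : ℝ) (r : ℝ≥0∞)
    (Y : Time T → Ω → A) : Prop where
  measurable : ∀ t, StronglyMeasurable (Y t)
  right_cont : RightContInProb P Y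
  memLp_zero : MemLp (Y (zeroTime hT)) (ENNReal.ofReal q) P
  finite : pVarTotal hT p
    (fun u v => condNorm P ℱ q r u (fun ω => Y v ω - Y u ω)) < ∞

/-- `L` is the limit in `L^q` of `Y_s` as `s ↗ t`. -/
def IsLeftLimit (P : Measure Ω) (q : ℝ) (Y : Time T → Ω → A) (t : Time T) (L : Ω → A) : Prop :=
  MemLp L (ENNReal.ofReal q) P ∧
    Tendsto (fun s => eLpNorm (fun ω => Y s ω - L ω) (ENNReal.ofReal q) P) (𝓝[<] t) (𝓝 0)

open Classical in
/-- (A version of) the left limit `Y_{t-}` in `L^q`; it is `0` if there is no such limit. -/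
def leftLimit (P : Measure Ω) (q : ℝ) (Y : Time T → Ω → A) (t : Time T) : Ω → A :=
  if h : ∃ L, IsLeftLimit P q Y t L then h.choose else 0

/-- The jump `ΔY_t = Y_t - Y_{t-}`, with the left limit in `L^q`. -/
def jump (P : Measure Ω) (q : ℝ) (Y : Time T → Ω → A) (t : Time T) : Ω → A :=
  fun ω => Y t ω - leftLimit P q Y t ω

end Processes

/-! ### Stochastic controlled paths and their brackets -/

section Controlled

variable {Ω : Type*} {mΩ : MeasurableSpace Ω} {T : ℝ} {d : ℕ}
  {E : Type*} [NormedAddCommGroup E] [NormedSpace ℝ E]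
  {F : Type*} [NormedAddCommGroup F] [NormedSpace ℝ F]
  {G : Type*} [NormedAddCommGroup G] [NormedSpace ℝ G]

/-- The remainder `R^Y_{s,t} = δY_{s,t} - Y'_s δX_{s,t}`. -/
def remainder (X : Time T → EuclideanSpace ℝ (Fin d)) (Y : Time T → Ω → E)
    (Y' : Time T → Ω → EuclideanSpace ℝ (Fin d) →L[ℝ] E) (s t : Time T) : Ω → E :=
  fun ω => (Y t ω - Y s ω) - Y' s ω (X t - X s)

/-- `(Y, Y')` is a stochastic controlled path relative to `X`, with exponents `p, q, r`. -/
structure IsControlled [CompleteSpace E] (hT : 0 < T) (P : Measure Ω)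
    (ℱ : Filtration (Time T) mΩ) (p q : ℝ)
    (r : ℝ≥0∞) (X : Time T → EuclideanSpace ℝ (Fin d)) (Y : Time T → Ω → E)
    (Y' : Time T → Ω → EuclideanSpace ℝ (Fin d) →L[ℝ] E) : Prop where
  adapted : StronglyAdapted ℱ Y
  adapted' : StronglyAdapted ℱ Y'
  mem : MemVLr hT P ℱ p q r Y
  mem' : MemVLr hT P ℱ p q r Y'
  bounded' : ⨆ s, eLpNorm (Y' s) (ENNReal.ofReal q * r) P < ∞
  condExp_remainder : pVarTotal hT (p / 2)
    (fun u v => eLpNorm (P[remainder X Y Y' u v | ℱ u]) (ENNReal.ofReal q * r) P) < ∞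

/-- The local approximation `δY_{u,v} ⊗ δZ_{u,v} - 2 (Y'_u ⊗ Z'_u) Sym(𝕏_{u,v})` of the bracket.
The space `G`, identified with `E ⊗ F` through `Φ`, is the tensor product `E ⊗ F` equipped with
a norm. -/
def bracketGerm (Φ : E ⊗[ℝ] F ≃ₗ[ℝ] G)
    (XX : Time T → Time T → EuclideanSpace ℝ (Fin d) ⊗[ℝ] EuclideanSpace ℝ (Fin d))
    (Y : Time T → Ω → E) (Y' : Time T → Ω → EuclideanSpace ℝ (Fin d) →L[ℝ] E)
    (Z : Time T → Ω → F) (Z' : Time T → Ω → EuclideanSpace ℝ (Fin d) →L[ℝ] F)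
    (u v : Time T) : Ω → G :=
  fun ω => Φ ((Y v ω - Y u ω) ⊗ₜ[ℝ] (Z v ω - Z u ω)
    - (2 : ℝ) • TensorProduct.map (Y' u ω : EuclideanSpace ℝ (Fin d) →ₗ[ℝ] E)
        (Z' u ω : EuclideanSpace ℝ (Fin d) →ₗ[ℝ] F) (symPart (XX u v)))

/-- `B` is the bracket `[Y,Z]` (up to modification) of the stochastic controlled paths `(Y, Y')`
and `(Z, Z')`: an adapted process in `V^{p/2} L^{q/2}` such that, for every `t`, `B_t` is the limit
in `L^{q/2}` of the sums of the local approximations along partitions of `[0,t]`, as the mesh size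
tends to zero. -/
structure IsBracket (hT : 0 < T) (P : Measure Ω) (ℱ : Filtration (Time T) mΩ) (p q : ℝ)
    (Φ : E ⊗[ℝ] F ≃ₗ[ℝ] G)
    (XX : Time T → Time T → EuclideanSpace ℝ (Fin d) ⊗[ℝ] EuclideanSpace ℝ (Fin d))
    (Y : Time T → Ω → E) (Y' : Time T → Ω → EuclideanSpace ℝ (Fin d) →L[ℝ] E)
    (Z : Time T → Ω → F) (Z' : Time T → Ω → EuclideanSpace ℝ (Fin d) →L[ℝ] F)
    (B : Time T → Ω → G) : Prop where
  adapted : StronglyAdapted ℱ B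
  mem : MemVL hT P (p / 2) (q / 2) B
  limit : ∀ t, ∀ ε : ℝ, 0 < ε → ∃ η : ℝ, 0 < η ∧
    ∀ π : Partition (zeroTime hT) t, π.MeshLT η →
      eLpNorm (B t - π.sum (bracketGerm Φ XX Y Y' Z Z')) (ENNReal.ofReal (q / 2)) P
        < ENNReal.ofReal ε

/-- `ΔY_s ⊗ ΔZ_s`. -/
def jumpTensor (P : Measure Ω) (q : ℝ) (Φ : E ⊗[ℝ] F ≃ₗ[ℝ] G) (Y : Time T → Ω → E)
    (Z : Time T → Ω → F) (s : Time T) : Ω → G :=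
  fun ω => Φ (jump P q Y s ω ⊗ₜ[ℝ] jump P q Z s ω)

/-- The deterministic times `s ∈ (0,t]` at which `‖ΔY_s ⊗ ΔZ_s‖_{L^{q/2}} ≠ 0`. -/
def jumpTimes (hT : 0 < T) (P : Measure Ω) (q : ℝ) (Φ : E ⊗[ℝ] F ≃ₗ[ℝ] G) (Y : Time T → Ω → E)
    (Z : Time T → Ω → F) (t : Time T) : Set (Time T) :=
  {s | zeroTime hT < s ∧ s ≤ t ∧ eLpNorm (jumpTensor P q Φ Y Z s) (ENNReal.ofReal (q / 2)) P ≠ 0}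

/-- `b = ∑_{0 < s ≤ t} ΔY_s ⊗ ΔZ_s`, the sum over the times in `jumpTimes`, as an (unordered) sum
in `L^{q/2}`: the net of the finite partial sums converges to `b` in `L^{q/2}`. -/
def IsJumpSum (hT : 0 < T) (P : Measure Ω) (q : ℝ) (Φ : E ⊗[ℝ] F ≃ₗ[ℝ] G) (Y : Time T → Ω → E)
    (Z : Time T → Ω → F) (t : Time T) (b : Ω → G) : Prop :=
  Tendsto (fun S : Finset (jumpTimes hT P q Φ Y Z t) =>
    eLpNorm (b - ∑ s ∈ S, jumpTensor P q Φ Y Z s) (ENNReal.ofReal (q / 2)) P) atTop (𝓝 0)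

end Controlled

end RoughStoch

end

open RoughStoch

/-!
Write `Γ u v = δM_{u,v} ⊗ δZ_{u,v}`; as the Gubinelli derivative of `M` is zero, this is the whole
bracket germ. With `δZ_{u,v} = Z'_u δX_{u,v} + R_{u,v}`, the sum of `Γ` over finitely many
non-overlapping intervals has two parts. The terms `δM_{u,v} ⊗ Z'_u δX_{u,v}` are martingale
differences, and their sum in `L^{q/2}` is controlled by the square function
`∑ ‖δM‖² |δX|²`, because martingale differences have type `2` in `L^m` for `m ≥ 2`
(`exists_eLpNorm_sum_le`, which rests on a second order expansion of `|x + y|^m`). The terms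
`δM_{u,v} ⊗ R_{u,v}` are summed as in Young integration, by `∑ ‖δM‖ ‖R‖`. The exponents
satisfy `4 / p > 1` and `1 / p + 2 / p > 1`, so in both parts a positive power of `‖δM‖` is left
over: the sum of `Γ` tends to zero with the largest increment of `M` over the intervals, however many
intervals there are (`IsJumpGerm.of_norm_sum_le`).

Hence the continuous part of `M` does not contribute. Outside a finite set `D` of times, short
intervals carry small increments of `M` (`IsCadlag.exists_finset`), so that they contribute little to
the partition sums; approximating `ΔM_s ⊗ ΔZ_s` by `Γ u s` with `u ↗ s`, the same holds for the sums
of the jumps outside `D`. This is Cauchy's criterion for the unconditional summability of the jumps.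
The finitely many intervals that meet `D` contribute the jumps at the times in `D` as the mesh tends
to zero (`IsJumpGerm.exists_meshLT`).

The sum of the jumps, as a function of time, is then the bracket: its `p/2`-variation is bounded by
that of `Γ` (`IsJumpGerm.sum_norm_jumpSum_sub_le`), and it has adapted versions because the partition
sums are adapted. All of this takes place for paths in the Banach spaces `L^q` and `L^{q/2}`;
the norm `‖·‖_{q,r,u}` dominates the norm of `L^q`, and finite `p`-variation turns right-continuity
in probability into càdlàg regularity in `L^q` (`isCadlag_lpPath`).
-/

/-! ### Finite families of non-overlapping intervals -/

/-- A finite family of intervals `(u, v]`, encoded by the pairs `(u, v)` of their end points, each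
of them non-empty and any two of them without common interior. -/
structure NonOverlapping {α : Type*} [LinearOrder α] (I : Finset (α × α)) : Prop where
  lt : ∀ i ∈ I, i.1 < i.2
  sep : ∀ i ∈ I, ∀ j ∈ I, i ≠ j → i.2 ≤ j.1 ∨ j.2 ≤ i.1

namespace NonOverlapping

variable {α : Type*} [LinearOrder α]

lemma empty : NonOverlapping (∅ : Finset (α × α)) := ⟨by simp, by simp⟩

lemma subset {I J : Finset (α × α)} (hJ : NonOverlapping J) (h : I ⊆ J) : NonOverlapping I :=
  ⟨fun i hi => hJ.lt i (h hi), fun i hi j hj => hJ.sep i (h hi) j (h hj)⟩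

lemma insert {I : Finset (α × α)} (hI : NonOverlapping I) {u v : α} (huv : u < v)
    (h : ∀ i ∈ I, i.2 ≤ u ∨ v ≤ i.1) : NonOverlapping (insert (u, v) I) := by
  refine ⟨?_, ?_⟩
  · intro i hi
    rcases Finset.mem_insert.1 hi with rfl | hi
    exacts [huv, hI.lt i hi]
  · intro i hi j hj hij
    rcases Finset.mem_insert.1 hi with rfl | hi <;> rcases Finset.mem_insert.1 hj with rfl | hj
    · exact absurd rfl hij
    · exact (h j hj).symm
    · exact h i hi
    · exact hI.sep i hi j hj hij

lemma singleton {u v : α} (h : u < v) : NonOverlapping {(u, v)} := by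
  simpa using (empty (α := α)).insert h (by simp)

/-- A point lies in at most one interval of the family. -/
lemma eq_of_mem {I : Finset (α × α)} (hI : NonOverlapping I) {i j : α × α} (hi : i ∈ I)
    (hj : j ∈ I) {s : α} (his : s ∈ Set.Ioc i.1 i.2) (hjs : s ∈ Set.Ioc j.1 j.2) : i = j := by
  by_contra hij
  rcases hI.sep i hi j hj hij with h | h
  · exact absurd (his.2.trans h) (not_le.2 hjs.1)
  · exact absurd (hjs.2.trans h) (not_le.2 his.1)

/-- If the sums of `g` over families are bounded, then `g` is small on all intervals with end points
in `S` which do not overlap a suitable family: one whose sum is nearly maximal. -/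
lemma exists_forall_lt (g : α → α → ℝ) {W : ℝ}
    (hg : ∀ I : Finset (α × α), NonOverlapping I → ∑ i ∈ I, g i.1 i.2 ≤ W) (S : Set α)
    {ε : ℝ} (hε : 0 < ε) :
    ∃ I : Finset (α × α), (∀ i ∈ I, i.1 < i.2 ∧ i.1 ∈ S ∧ i.2 ∈ S) ∧
      ∀ u ∈ S, ∀ v ∈ S, u < v → (∀ i ∈ I, i.2 ≤ u ∨ v ≤ i.1) → g u v < ε := by
  let V : Set ℝ := {x | ∃ I : Finset (α × α), NonOverlapping I ∧
    (∀ i ∈ I, i.1 ∈ S ∧ i.2 ∈ S) ∧ x = ∑ i ∈ I, g i.1 i.2}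
  have hne : V.Nonempty := ⟨_, ∅, empty, by simp, rfl⟩
  have hbdd : BddAbove V := ⟨W, by rintro x ⟨I, hI, -, rfl⟩; exact hg I hI⟩
  obtain ⟨x, ⟨I, hI, hIS, rfl⟩, hx⟩ := exists_lt_of_lt_csSup hne (sub_lt_self (sSup V) hε)
  refine ⟨I, fun i hi => ⟨hI.lt i hi, hIS i hi⟩, fun u hu v hv huv h => ?_⟩
  have hnot : (u, v) ∉ I := fun hmem => by
    rcases h _ hmem with h | h
    · exact absurd h (not_le.2 huv)
    · exact absurd h (not_le.2 huv)
  have hle : ∑ i ∈ Insert.insert (u, v) I, g i.1 i.2 ≤ sSup V := by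
    refine le_csSup hbdd ⟨_, hI.insert huv h, ?_, rfl⟩
    intro i hi
    rcases Finset.mem_insert.1 hi with rfl | hi
    exacts [⟨hu, hv⟩, hIS i hi]
  rw [Finset.sum_insert hnot] at hle
  simp only at hle
  linarith

end NonOverlapping

/-! ### Partitions as families of intervals -/

namespace RoughStoch.Partition

variable {T : ℝ} {s t : Time T}

/-- The family of the pairs of consecutive points of a partition. -/
noncomputable def pairs (π : Partition s t) : Finset (Time T × Time T) :=
  Finset.univ.image fun k : Fin π.n => (π.pt k.castSucc, π.pt k.succ)

lemma mem_pairs {π : Partition s t} {i : Time T × Time T} :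
    i ∈ π.pairs ↔ ∃ k : Fin π.n, (π.pt k.castSucc, π.pt k.succ) = i := by
  simp [pairs]

lemma sum_eq_sum_pairs {A : Type*} [AddCommMonoid A] (π : Partition s t)
    (f : Time T → Time T → A) : π.sum f = ∑ i ∈ π.pairs, f i.1 i.2 := by
  rw [pairs, Finset.sum_image, Partition.sum]
  intro k _ l _ h
  simpa using π.strictMono.injective (Prod.ext_iff.1 h).1

lemma nonOverlapping_pairs (π : Partition s t) : NonOverlapping π.pairs := by
  refine ⟨?_, ?_⟩
  · intro i hi
    obtain ⟨k, rfl⟩ := mem_pairs.1 hi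
    exact π.strictMono Fin.castSucc_lt_succ
  · intro i hi j hj hij
    obtain ⟨k, rfl⟩ := mem_pairs.1 hi
    obtain ⟨l, rfl⟩ := mem_pairs.1 hj
    rcases lt_trichotomy k l with h | h | h
    · exact Or.inl (π.strictMono.monotone (Fin.succ_le_castSucc_iff.2 h))
    · exact absurd (by rw [h]) hij
    · exact Or.inr (π.strictMono.monotone (Fin.succ_le_castSucc_iff.2 h))

lemma bounds_of_mem_pairs {π : Partition s t} {i : Time T × Time T} (hi : i ∈ π.pairs) :
    s ≤ i.1 ∧ i.2 ≤ t := by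
  obtain ⟨k, rfl⟩ := mem_pairs.1 hi
  refine ⟨?_, ?_⟩
  · conv_lhs => rw [← π.first]
    exact π.strictMono.monotone (Fin.zero_le _)
  · conv_rhs => rw [← π.last]
    exact π.strictMono.monotone (Fin.le_last _)

lemma exists_mem_pairs (π : Partition s t) {x : Time T} (hs : s < x) (ht : x ≤ t) :
    ∃ i ∈ π.pairs, x ∈ Set.Ioc i.1 i.2 := by
  classical
  have hex : ∃ k : ℕ, ∃ h : k < π.n + 1, x ≤ π.pt ⟨k, h⟩ :=
    ⟨π.n, Nat.lt_succ_self _, by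
      have := π.last
      rw [show (⟨π.n, Nat.lt_succ_self _⟩ : Fin (π.n + 1)) = Fin.last π.n from rfl, this]
      exact ht⟩
  obtain ⟨hk, hxk⟩ := Nat.find_spec hex
  have hmin := fun {m : ℕ} => Nat.find_min hex (m := m)
  set k := Nat.find hex
  have hk0 : k ≠ 0 := by
    intro h0
    have : π.pt ⟨k, hk⟩ = s := (congrArg π.pt (Fin.ext h0)).trans π.first
    rw [this] at hxk
    exact absurd hxk (not_le.2 hs)
  obtain ⟨m, hm⟩ := Nat.exists_eq_succ_of_ne_zero hk0
  have hmn : m < π.n := by omega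
  refine ⟨_, mem_pairs.2 ⟨⟨m, hmn⟩, rfl⟩, ?_, ?_⟩
  · by_contra hlt
    exact hmin (m := m) (by omega) ⟨by omega, not_lt.1 hlt⟩
  · have : (⟨m, hmn⟩ : Fin π.n).succ = ⟨k, hk⟩ := Fin.ext (by simp [hm])
    simpa only [this] using hxk

lemma MeshLT.lt_of_mem_pairs {π : Partition s t} {η : ℝ} (h : π.MeshLT η) {i : Time T × Time T}
    (hi : i ∈ π.pairs) : (i.2 : ℝ) - i.1 < η := by
  obtain ⟨k, rfl⟩ := mem_pairs.1 hi
  exact h k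

/-- The intervals of a non-overlapping family belong to a common partition. -/
lemma exists_subset_pairs {hT : 0 < T} {I : Finset (Time T × Time T)} (hI : NonOverlapping I) :
    ∃ π : Partition (zeroTime hT) (⟨T, hT.le, le_refl T⟩ : Time T), I ⊆ π.pairs := by
  classical
  let A : Finset (Time T) :=
    insert (zeroTime hT) (insert ⟨T, hT.le, le_refl T⟩ (I.image Prod.fst ∪ I.image Prod.snd))
  have hA0 : zeroTime hT ∈ A := by simp [A]
  have hAT : (⟨T, hT.le, le_refl T⟩ : Time T) ∈ A := by simp [A]
  have hcard : A.card = (A.card - 1) + 1 := by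
    have := Finset.card_pos.2 ⟨_, hA0⟩
    omega
  have hAI : ∀ x ∈ A, ∀ i ∈ I, x ≤ i.1 ∨ i.2 ≤ x := by
    intro x hx i hi
    simp only [A, Finset.mem_insert, Finset.mem_union, Finset.mem_image] at hx
    rcases hx with rfl | rfl | ⟨j, hj, rfl⟩ | ⟨j, hj, rfl⟩
    · exact Or.inl i.1.2.1
    · exact Or.inr i.2.2.2
    · by_cases hij : j = i
      · exact Or.inl (by rw [hij])
      · rcases hI.sep j hj i hi hij with h | h
        exacts [Or.inl ((hI.lt j hj).le.trans h), Or.inr h]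
    · by_cases hij : j = i
      · exact Or.inr (by rw [hij])
      · rcases hI.sep j hj i hi hij with h | h
        exacts [Or.inl h, Or.inr (h.trans (hI.lt j hj).le)]
  let e := A.orderEmbOfFin hcard
  let π : Partition (zeroTime hT) (⟨T, hT.le, le_refl T⟩ : Time T) :=
    { n := A.card - 1
      pt := e
      strictMono := e.strictMono
      first := by
        refine le_antisymm ?_ (e 0).2.1
        obtain ⟨a, ha⟩ : zeroTime hT ∈ Set.range e := by
          rw [Finset.range_orderEmbOfFin]
          exact hA0
        rw [← ha]
        exact e.monotone (Fin.zero_le _)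
      last := by
        refine le_antisymm (e _).2.2 ?_
        obtain ⟨a, ha⟩ : (⟨T, hT.le, le_refl T⟩ : Time T) ∈ Set.range e := by
          rw [Finset.range_orderEmbOfFin]
          exact hAT
        rw [← ha]
        exact e.monotone (Fin.le_last _) }
  refine ⟨π, fun i hi => ?_⟩
  obtain ⟨a, ha⟩ : i.1 ∈ Set.range e := by
    rw [Finset.range_orderEmbOfFin]
    exact Finset.mem_coe.2 (by
      simp only [A, Finset.mem_insert, Finset.mem_union]
      exact Or.inr (Or.inr (Or.inl (Finset.mem_image_of_mem _ hi))))
  obtain ⟨b, hb⟩ : i.2 ∈ Set.range e := by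
    rw [Finset.range_orderEmbOfFin]
    exact Finset.mem_coe.2 (by
      simp only [A, Finset.mem_insert, Finset.mem_union]
      exact Or.inr (Or.inr (Or.inr (Finset.mem_image_of_mem _ hi))))
  have hab : a < b := e.lt_iff_lt.1 (by rw [ha, hb]; exact hI.lt i hi)
  have han : (a : ℕ) < A.card - 1 := by
    have := b.2
    have : (a : ℕ) < b := hab
    omega
  refine mem_pairs.2 ⟨⟨a, han⟩, ?_⟩
  have h1 : (⟨a, han⟩ : Fin (A.card - 1)).castSucc = a := Fin.ext rfl
  have h2 : (⟨a, han⟩ : Fin (A.card - 1)).succ = b := by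
    refine le_antisymm (Fin.le_def.2 (by simpa using Nat.succ_le_of_lt hab)) ?_
    rw [← e.le_iff_le, hb]
    refine (hAI (e _) (Finset.orderEmbOfFin_mem _ _ _) i hi).resolve_left (not_le.2 ?_)
    rw [← ha, e.lt_iff_lt]
    exact Fin.lt_def.2 (by simp)
  exact Prod.ext ((congrArg e h1).trans ha) ((congrArg e h2).trans hb)

lemma exists_meshLT (hT : 0 < T) (t : Time T) {η : ℝ} (hη : 0 < η) :
    ∃ π : Partition (zeroTime hT) t, π.MeshLT η := by
  rcases eq_or_lt_of_le (show zeroTime hT ≤ t from t.2.1) with h0 | h0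
  · refine ⟨⟨0, fun _ => t, fun a b hab => absurd (show (a : ℕ) < b from hab) (by omega),
      h0.symm, rfl⟩, fun i => i.elim0⟩
  · have ht : (0 : ℝ) < t := h0
    obtain ⟨N, hN⟩ := exists_nat_gt ((t : ℝ) / η)
    have hNpos : (0 : ℝ) < N := (div_pos ht hη).trans hN
    have hmem : ∀ k : Fin (N + 1), (k : ℝ) / N * t ∈ Set.Icc (0 : ℝ) T := fun k => by
      refine ⟨by positivity, le_trans ?_ t.2.2⟩
      have : (k : ℝ) / N ≤ 1 := by
        rw [div_le_one hNpos]
        exact_mod_cast Nat.lt_succ_iff.1 k.2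
      nlinarith
    refine ⟨⟨N, fun k => ⟨(k : ℝ) / N * t, hmem k⟩, ?_, ?_, ?_⟩, ?_⟩
    · intro a b hab
      rw [Subtype.mk_lt_mk]
      have : (a : ℝ) < b := by exact_mod_cast hab
      gcongr
    · exact Subtype.ext (by simp [zeroTime])
    · exact Subtype.ext (by simp [hNpos.ne'])
    · intro i
      have : ((i.succ : Fin (N + 1)) : ℝ) / N * t - ((i.castSucc : Fin (N + 1)) : ℝ) / N * t
          = t / N := by
        simp only [Fin.val_succ, Fin.val_castSucc]
        push_cast
        ring
      change ((i.succ : Fin (N + 1)) : ℝ) / N * t - ((i.castSucc : Fin (N + 1)) : ℝ) / N * t < η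
      rw [this, div_lt_iff₀ hNpos]
      rwa [div_lt_iff₀ hη, mul_comm] at hN

end RoughStoch.Partition

/-- A finite `p`-variation bounds the sums of the `p`-th powers over non-overlapping families. -/
lemma exists_sum_rpow_le_of_pVarTotal {T : ℝ} {hT : 0 < T} {p : ℝ} (hp : 0 < p)
    {f : Time T → Time T → ℝ≥0∞} (hf : pVarTotal hT p f < ∞) :
    ∃ W : ℝ, 0 ≤ W ∧ ∀ I : Finset (Time T × Time T), NonOverlapping I →
      ∑ i ∈ I, (f i.1 i.2).toReal ^ p ≤ W := by
  have hp' : 0 < 1 / p := one_div_pos.2 hp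
  have hlt : (⨆ π : Partition (zeroTime hT) (⟨T, hT.le, le_refl T⟩ : Time T),
      π.sum (fun u v => f u v ^ p)) < ∞ := by
    have := hf
    rw [pVarTotal, pVar, ENNReal.rpow_lt_top_iff_of_pos hp'] at this
    exact this
  refine ⟨(⨆ π : Partition (zeroTime hT) (⟨T, hT.le, le_refl T⟩ : Time T),
    π.sum (fun u v => f u v ^ p)).toReal, ENNReal.toReal_nonneg, fun I hI => ?_⟩
  obtain ⟨π, hπ⟩ := Partition.exists_subset_pairs (hT := hT) hI
  have hle : ∑ i ∈ I, f i.1 i.2 ^ p ≤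
      ⨆ π : Partition (zeroTime hT) (⟨T, hT.le, le_refl T⟩ : Time T),
        π.sum (fun u v => f u v ^ p) :=
    ((Finset.sum_le_sum_of_subset hπ).trans
      (π.sum_eq_sum_pairs (fun u v => f u v ^ p)).ge).trans
      (le_iSup (fun π : Partition (zeroTime hT) (⟨T, hT.le, le_refl T⟩ : Time T) =>
        π.sum (fun u v => f u v ^ p)) π)
  have hne : ∀ i ∈ I, f i.1 i.2 ^ p ≠ ∞ := fun i hi =>
    ((Finset.single_le_sum (f := fun i : Time T × Time T => f i.1 i.2 ^ p)
      (fun _ _ => zero_le) hi).trans_lt (hle.trans_lt hlt)).ne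
  have := ENNReal.toReal_mono hlt.ne hle
  rw [ENNReal.toReal_sum hne] at this
  simpa only [ENNReal.toReal_rpow] using this

lemma lt_top_of_pVarTotal {T : ℝ} {hT : 0 < T} {p : ℝ} (hp : 0 < p)
    {f : Time T → Time T → ℝ≥0∞} (hf : pVarTotal hT p f < ∞) {u v : Time T} (huv : u < v) :
    f u v < ∞ := by
  have hp' : 0 < 1 / p := one_div_pos.2 hp
  rw [pVarTotal, pVar, ENNReal.rpow_lt_top_iff_of_pos hp'] at hf
  obtain ⟨π, hπ⟩ := Partition.exists_subset_pairs (hT := hT) (NonOverlapping.singleton huv)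
  have hmem : (u, v) ∈ π.pairs := hπ (Finset.mem_singleton_self _)
  have h1 : f u v ^ p ≤ π.sum (fun u v => f u v ^ p) := by
    rw [π.sum_eq_sum_pairs]
    exact Finset.single_le_sum (f := fun i : Time T × Time T => f i.1 i.2 ^ p)
      (fun _ _ => zero_le) hmem
  have h2 := (h1.trans (le_iSup (fun π : Partition (zeroTime hT)
    (⟨T, hT.le, le_refl T⟩ : Time T) => π.sum (fun u v => f u v ^ p)) π)).trans_lt hf
  rwa [ENNReal.rpow_lt_top_iff_of_pos hp] at h2

/-! ### Regulated paths -/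

section Regulated

variable {T : ℝ} {A : Type*} [MetricSpace A] {f : Time T → A} {p W : ℝ}

lemma neBot_nhdsLT {hT : 0 < T} {t : Time T} (ht : zeroTime hT < t) : (𝓝[<] t).NeBot :=
  nhdsLT_neBot_of_exists_lt ⟨_, ht⟩

/-- A path of finite `p`-variation in a complete space has left limits. -/
lemma exists_tendsto_nhdsLT [CompleteSpace A] (hp : 0 < p) [Nonempty A]
    (hf : ∀ I : Finset (Time T × Time T), NonOverlapping I →
      ∑ i ∈ I, dist (f i.1) (f i.2) ^ p ≤ W) (t : Time T) :
    ∃ l, Tendsto f (𝓝[<] t) (𝓝 l) := by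
  rcases (𝓝[<] t).eq_or_neBot with h | h
  · rw [h]
    exact ⟨Classical.arbitrary A, tendsto_bot⟩
  refine cauchy_map_iff_exists_tendsto.1 (Metric.cauchy_iff.2 ⟨inferInstance, fun ε hε => ?_⟩)
  obtain ⟨I, hI, hlt⟩ := NonOverlapping.exists_forall_lt (fun u v => dist (f u) (f v) ^ p) hf
    (Set.Iio t) (Real.rpow_pos_of_pos hε p)
  have key : ∀ u v, u < t → v < t → (∀ i ∈ I, i.2 ≤ u) → u < v → dist (f u) (f v) < ε :=
    fun u v hu hv hi huv => (Real.rpow_lt_rpow_iff dist_nonneg hε.le hp).1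
      (hlt u hu v hv huv fun i hiI => Or.inl (hi i hiI))
  refine ⟨f '' {u | u < t ∧ ∀ i ∈ I, i.2 ≤ u}, image_mem_map ?_, ?_⟩
  · refine inter_mem self_mem_nhdsWithin (nhdsWithin_le_nhds ?_)
    exact (I.eventually_all).2 fun i hi => Filter.Eventually.mono
      (Ioi_mem_nhds (hI i hi).2.2) fun x hx => le_of_lt hx
  · rintro _ ⟨u, hu, rfl⟩ _ ⟨v, hv, rfl⟩
    rcases lt_trichotomy u v with h | h | h
    · exact key u v hu.1 hv.1 hu.2 h
    · rwa [h, dist_self]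
    · rw [dist_comm]
      exact key v u hv.1 hu.1 hv.2 h

/-- A path of finite `p`-variation in a complete space has right limits. -/
lemma exists_tendsto_nhdsGT [CompleteSpace A] (hp : 0 < p) [Nonempty A]
    (hf : ∀ I : Finset (Time T × Time T), NonOverlapping I →
      ∑ i ∈ I, dist (f i.1) (f i.2) ^ p ≤ W) (t : Time T) :
    ∃ l, Tendsto f (𝓝[>] t) (𝓝 l) := by
  rcases (𝓝[>] t).eq_or_neBot with h | h
  · rw [h]
    exact ⟨Classical.arbitrary A, tendsto_bot⟩
  refine cauchy_map_iff_exists_tendsto.1 (Metric.cauchy_iff.2 ⟨inferInstance, fun ε hε => ?_⟩)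
  obtain ⟨I, hI, hlt⟩ := NonOverlapping.exists_forall_lt (fun u v => dist (f u) (f v) ^ p) hf
    (Set.Ioi t) (Real.rpow_pos_of_pos hε p)
  have key : ∀ u v, t < u → t < v → (∀ i ∈ I, v ≤ i.1) → u < v → dist (f u) (f v) < ε :=
    fun u v hu hv hi huv => (Real.rpow_lt_rpow_iff dist_nonneg hε.le hp).1
      (hlt u hu v hv huv fun i hiI => Or.inr (hi i hiI))
  refine ⟨f '' {u | t < u ∧ ∀ i ∈ I, u ≤ i.1}, image_mem_map ?_, ?_⟩
  · refine inter_mem self_mem_nhdsWithin (nhdsWithin_le_nhds ?_)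
    exact (I.eventually_all).2 fun i hi => Filter.Eventually.mono
      (Iio_mem_nhds (hI i hi).2.1) fun x hx => le_of_lt hx
  · rintro _ ⟨u, hu, rfl⟩ _ ⟨v, hv, rfl⟩
    rcases lt_trichotomy u v with h | h | h
    · exact key u v hu.1 hv.1 hv.2 h
    · rwa [h, dist_self]
    · rw [dist_comm]
      exact key v u hv.1 hu.1 hu.2 h

/-- Outside finitely many times, a càdlàg path is uniformly continuous: short intervals `(u, v]`
which avoid these times carry small increments. -/
lemma RoughStoch.IsCadlag.exists_finset (hf : IsCadlag f) {ε : ℝ} (hε : 0 < ε) :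
    ∃ (D : Finset (Time T)) (η : ℝ), 0 < η ∧ ∀ u v : Time T, u < v → (v : ℝ) - u < η →
      (∀ s ∈ D, s ∉ Set.Ioc u v) → dist (f u) (f v) ≤ ε := by
  classical
  have hloc : ∀ s : Time T, ∃ δ > 0, ∀ u v, dist u s < δ → dist v s < δ → u < v →
      (v < s ∨ s ≤ u) → dist (f u) (f v) ≤ ε := by
    intro s
    obtain ⟨hr, l, hl⟩ := hf s
    obtain ⟨δ₁, h₁, H₁⟩ := Metric.tendsto_nhdsWithin_nhds.1 hr (ε / 2) (half_pos hε)
    obtain ⟨δ₂, h₂, H₂⟩ := Metric.tendsto_nhdsWithin_nhds.1 hl (ε / 2) (half_pos hε)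
    refine ⟨min δ₁ δ₂, lt_min h₁ h₂, fun u v hu hv huv h => ?_⟩
    rcases h with h | h
    · have := dist_triangle_right (f u) (f v) l
      have h1 := H₂ (show u ∈ Set.Iio s from huv.trans h) (hu.trans_le (min_le_right _ _))
      have h2 := H₂ (show v ∈ Set.Iio s from h) (hv.trans_le (min_le_right _ _))
      linarith
    · have := dist_triangle_right (f u) (f v) (f s)
      have h1 := H₁ (show u ∈ Set.Ici s from h) (hu.trans_le (min_le_left _ _))
      have h2 := H₁ (show v ∈ Set.Ici s from h.trans huv.le) (hv.trans_le (min_le_left _ _))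
      linarith
  choose δ hδ H using hloc
  obtain ⟨D, hD⟩ := isCompact_univ.elim_finite_subcover (fun s : Time T => Metric.ball s (δ s))
    (fun s => Metric.isOpen_ball)
    (fun s _ => Set.mem_iUnion.2 ⟨s, Metric.mem_ball_self (hδ s)⟩)
  obtain ⟨η, hη, hleb⟩ := lebesgue_number_lemma_of_metric (c := fun s : D =>
    Metric.ball (s : Time T) (δ s)) isCompact_univ (fun s => Metric.isOpen_ball) (by
      intro x hx
      obtain ⟨s, hs, hxs⟩ := Set.mem_iUnion₂.1 (hD hx)
      exact Set.mem_iUnion.2 ⟨⟨s, hs⟩, hxs⟩)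
  refine ⟨D, η, hη, fun u v huv hlt hDuv => ?_⟩
  obtain ⟨s, hs⟩ := hleb u (Set.mem_univ _)
  have hv : v ∈ Metric.ball u η := by
    rw [Metric.mem_ball, Subtype.dist_eq, Real.dist_eq,
      abs_of_pos (sub_pos.2 (show (u : ℝ) < v from huv))]
    exact hlt
  refine H s u v (hs (Metric.mem_ball_self hη)) (hs hv) huv ?_
  have := hDuv s s.2
  by_contra! hcon
  exact this ⟨hcon.2, hcon.1⟩

end Regulated

/-! ### Germs which sum up to their jumps -/

/-- A two-parameter germ `Γ` with jumps `J`, dominated by a path `f`: sums of `Γ` over families of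
intervals are controlled by an additive functional `g` of finite total mass, and they are small as
soon as the increments of `f` over the intervals are. -/
structure IsJumpGerm {T : ℝ} {A H : Type*} [MetricSpace A] [NormedAddCommGroup H] (hT : 0 < T)
    (f : Time T → A) (Γ : Time T → Time T → H) (J : Time T → H) (g : Time T → Time T → ℝ)
    (κ W : ℝ) : Prop where
  cadlag : IsCadlag f
  zero : J (zeroTime hT) = 0
  tendsto : ∀ s, zeroTime hT < s →
    Tendsto (fun i : Time T × Time T => Γ i.1 i.2) (𝓝[<] s ×ˢ 𝓝[≥] s) (𝓝 (J s))
  nonneg : ∀ u v, u < v → 0 ≤ g u v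
  sum_le : ∀ I : Finset (Time T × Time T), NonOverlapping I → ∑ i ∈ I, g i.1 i.2 ≤ W
  norm_le : ∀ I : Finset (Time T × Time T), NonOverlapping I →
    ‖∑ i ∈ I, Γ i.1 i.2‖ ^ κ ≤ ∑ i ∈ I, g i.1 i.2
  small : ∀ ε > 0, ∃ c > 0, ∀ I : Finset (Time T × Time T), NonOverlapping I →
    (∀ i ∈ I, dist (f i.1) (f i.2) ≤ c) → ‖∑ i ∈ I, Γ i.1 i.2‖ ≤ ε

namespace IsJumpGerm

variable {T : ℝ} {A H : Type*} [MetricSpace A] [NormedAddCommGroup H] {hT : 0 < T}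
  {f : Time T → A} {Γ : Time T → Time T → H} {J : Time T → H} {g : Time T → Time T → ℝ} {κ W : ℝ}

lemma exists_left_seq (hT : 0 < T) : ∃ σ : ℕ → Time T → Time T, ∀ s, zeroTime hT < s →
    Tendsto (fun n => σ n s) atTop (𝓝[<] s) := by
  have : ∀ s : Time T, ∃ x : ℕ → Time T, zeroTime hT < s → Tendsto x atTop (𝓝[<] s) := by
    intro s
    by_cases hs : zeroTime hT < s
    · have := neBot_nhdsLT hs
      obtain ⟨x, hx⟩ := Filter.exists_seq_tendsto (𝓝[<] s)
      exact ⟨x, fun _ => hx⟩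
    · exact ⟨fun _ => s, fun h => absurd h hs⟩
  choose x hx using this
  exact ⟨fun n s => x s n, hx⟩

lemma eventually_nonOverlapping {σ : ℕ → Time T → Time T}
    (hσ : ∀ s, zeroTime hT < s → Tendsto (fun n => σ n s) atTop (𝓝[<] s))
    {S : Finset (Time T)} (hS : ∀ s ∈ S, zeroTime hT < s) :
    ∀ᶠ n in atTop, NonOverlapping (S.image fun s => (σ n s, s)) := by
  have h1 : ∀ᶠ n in atTop, ∀ s ∈ S, σ n s < s :=
    (S.eventually_all).2 fun s hs => (hσ s (hS s hs)).eventually self_mem_nhdsWithin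
  have h2 : ∀ᶠ n in atTop, ∀ s ∈ S, ∀ s' ∈ S, s' < s → s' ≤ σ n s := by
    refine (S.eventually_all).2 fun s hs => (S.eventually_all).2 fun s' _ => ?_
    by_cases h : s' < s
    · filter_upwards [(hσ s (hS s hs)).eventually (nhdsWithin_le_nhds (Ioi_mem_nhds h))] with n hn _
      exact le_of_lt hn
    · exact Eventually.of_forall fun n h' => absurd h' h
  filter_upwards [h1, h2] with n hn1 hn2
  refine ⟨?_, ?_⟩
  · intro i hi
    obtain ⟨s, hs, rfl⟩ := Finset.mem_image.1 hi
    exact hn1 s hs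
  · intro i hi j hj hij
    obtain ⟨s, hs, rfl⟩ := Finset.mem_image.1 hi
    obtain ⟨s', hs', rfl⟩ := Finset.mem_image.1 hj
    rcases lt_trichotomy s s' with h | h | h
    · exact Or.inl (hn2 s' hs' s hs h)
    · exact absurd (by rw [h]) hij
    · exact Or.inr (hn2 s hs s' hs' h)

lemma sum_image_left {B : Type*} [AddCommMonoid B] (x : Time T → Time T) (S : Finset (Time T))
    (F : Time T → Time T → B) :
    ∑ i ∈ S.image (fun s => (x s, s)), F i.1 i.2 = ∑ s ∈ S, F (x s) s :=
  Finset.sum_image fun _ _ _ _ h => (Prod.ext_iff.1 h).2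

lemma tendsto_left (h : IsJumpGerm hT f Γ J g κ W) {σ : ℕ → Time T → Time T}
    (hσ : ∀ s, zeroTime hT < s → Tendsto (fun n => σ n s) atTop (𝓝[<] s))
    {S : Finset (Time T)} (hS : ∀ s ∈ S, zeroTime hT < s) :
    Tendsto (fun n => ∑ s ∈ S, Γ (σ n s) s) atTop (𝓝 (∑ s ∈ S, J s)) := by
  refine tendsto_finsetSum _ fun s hs => ?_
  exact (h.tendsto s (hS s hs)).comp ((hσ s (hS s hs)).prodMk
    (tendsto_nhdsWithin_of_tendsto_nhds_of_eventually_within _ tendsto_const_nhds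
      (Eventually.of_forall fun _ => Set.mem_Ici.2 le_rfl)))

/-- Away from finitely many times, both the sums of the germ over short intervals and the sums of
the jumps are small. -/
lemma exists_finset (h : IsJumpGerm hT f Γ J g κ W) {ε : ℝ} (hε : 0 < ε) :
    ∃ (D : Finset (Time T)) (η : ℝ), 0 < η ∧
      (∀ I : Finset (Time T × Time T), NonOverlapping I →
        (∀ i ∈ I, (i.2 : ℝ) - i.1 < η ∧ ∀ s ∈ D, s ∉ Set.Ioc i.1 i.2) →
        ‖∑ i ∈ I, Γ i.1 i.2‖ ≤ ε) ∧
      ∀ S : Finset (Time T), Disjoint S D → ‖∑ s ∈ S, J s‖ ≤ ε := by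
  classical
  obtain ⟨c, hc, hsmall⟩ := h.small ε hε
  obtain ⟨D, η, hη, hD⟩ := h.cadlag.exists_finset hc
  have key : ∀ I : Finset (Time T × Time T), NonOverlapping I →
      (∀ i ∈ I, (i.2 : ℝ) - i.1 < η ∧ ∀ s ∈ D, s ∉ Set.Ioc i.1 i.2) →
      ‖∑ i ∈ I, Γ i.1 i.2‖ ≤ ε := fun I hI hi =>
    hsmall I hI fun i hiI => hD i.1 i.2 (hI.lt i hiI) (hi i hiI).1 (hi i hiI).2
  refine ⟨insert (zeroTime hT) D, η, hη, fun I hI hi => key I hI fun i hiI =>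
    ⟨(hi i hiI).1, fun s hs => (hi i hiI).2 s (Finset.mem_insert_of_mem hs)⟩, fun S hS => ?_⟩
  rw [Finset.disjoint_insert_right] at hS
  have hS0 : ∀ s ∈ S, zeroTime hT < s := fun s hs =>
    lt_of_le_of_ne s.2.1 fun h0 => hS.1 (by rwa [show zeroTime hT = s from h0])
  obtain ⟨σ, hσ⟩ := exists_left_seq hT
  refine le_of_tendsto (h.tendsto_left hσ hS0).norm ?_
  have h1 : ∀ᶠ n in atTop, ∀ s ∈ S, σ n s < s ∧ (s : ℝ) - σ n s < η := by
    refine (S.eventually_all).2 fun s hs =>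
      ((hσ s (hS0 s hs)).eventually self_mem_nhdsWithin).and ?_
    have : Tendsto (fun n => (s : ℝ) - σ n s) atTop (𝓝 ((s : ℝ) - s)) :=
      tendsto_const_nhds.sub ((continuous_subtype_val.tendsto s).comp
        ((hσ s (hS0 s hs)).mono_right nhdsWithin_le_nhds))
    rw [sub_self] at this
    exact this.eventually (Iio_mem_nhds hη)
  have h2 : ∀ᶠ n in atTop, ∀ s ∈ S, ∀ s' ∈ D, s' ∉ Set.Ioc (σ n s) s := by
    refine (S.eventually_all).2 fun s hs => (D.eventually_all).2 fun s' hs' => ?_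
    rcases lt_trichotomy s' s with hlt | heq | hgt
    · filter_upwards [(hσ s (hS0 s hs)).eventually (nhdsWithin_le_nhds (Ioi_mem_nhds hlt))]
        with n hn hmem
      exact lt_asymm hn hmem.1
    · exact absurd hs' (heq ▸ Finset.disjoint_left.1 hS.2 hs)
    · exact Eventually.of_forall fun n hmem => absurd hmem.2 (not_le.2 hgt)
  filter_upwards [eventually_nonOverlapping hσ hS0, h1, h2] with n hn h1 h2
  rw [← sum_image_left (σ n) S Γ]
  refine key _ hn fun i hi => ?_
  obtain ⟨s, hs, rfl⟩ := Finset.mem_image.1 hi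
  exact ⟨(h1 s hs).2, h2 s hs⟩

lemma summable [CompleteSpace H] (h : IsJumpGerm hT f Γ J g κ W) : Summable J := by
  refine summable_iff_vanishing_norm.2 fun ε hε => ?_
  obtain ⟨D, -, -, -, hD⟩ := h.exists_finset (half_pos hε)
  exact ⟨D, fun S hS => (hD S hS).trans_lt (half_lt_self hε)⟩

/-- The sum of the jumps at the times in `(0, t]`. -/
noncomputable def jumpSum (J : Time T → H) (t : Time T) : H := ∑' s, (Set.Iic t).indicator J s

/-- If all finite sums of jumps away from `D` are at most `ε`, then the sum of the jumps in a set
differs by at most `ε` from the sum over the times in `D`. -/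
lemma norm_sub_sum_le {D : Finset (Time T)} {ε : ℝ}
    (hD : ∀ S : Finset (Time T), Disjoint S D → ‖∑ s ∈ S, J s‖ ≤ ε) {K : Set (Time T)} {b : H}
    (hb : HasSum (K.indicator J) b) : ‖b - ∑ s ∈ D, K.indicator J s‖ ≤ ε := by
  classical
  refine le_of_tendsto (Tendsto.norm (Tendsto.sub (f := fun S => ∑ s ∈ S, K.indicator J s)
    hb tendsto_const_nhds)) ?_
  filter_upwards [eventually_ge_atTop D] with S hS
  rw [← Finset.sum_sdiff_eq_sub hS, Finset.sum_indicator_eq_sum_filter]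
  exact hD _ (Finset.disjoint_of_subset_left (Finset.filter_subset _ _) Finset.sdiff_disjoint)

variable [CompleteSpace H]

lemma hasSum_jumpSum (h : IsJumpGerm hT f Γ J g κ W) (t : Time T) :
    HasSum ((Set.Iic t).indicator J) (jumpSum J t) :=
  (h.summable.indicator _).hasSum

lemma hasSum_jumpSum_sub (h : IsJumpGerm hT f Γ J g κ W) {u v : Time T} (huv : u ≤ v) :
    HasSum ((Set.Ioc u v).indicator J) (jumpSum J v - jumpSum J u) := by
  convert (h.hasSum_jumpSum v).sub (h.hasSum_jumpSum u) using 1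
  funext s
  by_cases h1 : s ≤ u
  · simp [Set.indicator, h1, h1.trans huv, not_lt.2 h1]
  · by_cases h2 : s ≤ v <;> simp [Set.indicator, h1, h2, not_le.1 h1]

/-- The `κ`-variation of the sum of the jumps is bounded by that of the germ. -/
lemma sum_norm_jumpSum_sub_le (h : IsJumpGerm hT f Γ J g κ W) (hκ : 0 < κ)
    {I : Finset (Time T × Time T)} (hI : NonOverlapping I) :
    ∑ i ∈ I, ‖jumpSum J i.2 - jumpSum J i.1‖ ^ κ ≤ W := by
  classical
  have hlim : Tendsto (fun S : Finset (Time T) =>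
      ∑ i ∈ I, ‖∑ s ∈ S, (Set.Ioc i.1 i.2).indicator J s‖ ^ κ) atTop
      (𝓝 (∑ i ∈ I, ‖jumpSum J i.2 - jumpSum J i.1‖ ^ κ)) :=
    tendsto_finsetSum _ fun i hi =>
      (Tendsto.norm (h.hasSum_jumpSum_sub (hI.lt i hi).le)).rpow_const (Or.inr hκ.le)
  refine le_of_tendsto hlim (Eventually.of_forall fun S => ?_)
  obtain ⟨σ, hσ⟩ := exists_left_seq hT
  -- The part of `S` in an interval of the family; it does not contain the time `0`.
  let Sf : Time T × Time T → Finset (Time T) := fun i => S.filter (· ∈ Set.Ioc i.1 i.2)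
  have hSf0 : ∀ i, ∀ s ∈ Sf i, zeroTime hT < s := fun i s hs =>
    lt_of_le_of_lt i.1.2.1 (Finset.mem_filter.1 hs).2.1
  have hlim' : Tendsto (fun n => ∑ i ∈ I, ‖∑ s ∈ Sf i, Γ (σ n s) s‖ ^ κ) atTop
      (𝓝 (∑ i ∈ I, ‖∑ s ∈ Sf i, J s‖ ^ κ)) :=
    tendsto_finsetSum _ fun i hi =>
      (h.tendsto_left hσ (hSf0 i)).norm.rpow_const (Or.inr hκ.le)
  have hSf : ∀ i : Time T × Time T,
      ∑ s ∈ S, (Set.Ioc i.1 i.2).indicator J s = ∑ s ∈ Sf i, J s := fun i =>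
    Finset.sum_indicator_eq_sum_filter S (fun _ => J) (fun _ => Set.Ioc i.1 i.2) id
  rw [Finset.sum_congr rfl fun i _ => by rw [hSf i]]
  refine le_of_tendsto hlim' ?_
  let S' := S.filter (zeroTime hT < ·)
  have hS' : ∀ s ∈ S', zeroTime hT < s := fun s hs => (Finset.mem_filter.1 hs).2
  have hsub : ∀ i, Sf i ⊆ S' := fun i s hs =>
    Finset.mem_filter.2 ⟨(Finset.mem_filter.1 hs).1, hSf0 i s hs⟩
  filter_upwards [eventually_nonOverlapping hσ hS'] with n hn
  have hg : ∀ s ∈ S', 0 ≤ g (σ n s) s := fun s hs =>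
    h.nonneg _ _ (hn.lt _ (Finset.mem_image_of_mem (fun s => (σ n s, s)) hs))
  calc ∑ i ∈ I, ‖∑ s ∈ Sf i, Γ (σ n s) s‖ ^ κ
      ≤ ∑ i ∈ I, ∑ s ∈ Sf i, g (σ n s) s := by
        refine Finset.sum_le_sum fun i _ => ?_
        rw [← sum_image_left (σ n) (Sf i) Γ, ← sum_image_left (σ n) (Sf i) g]
        exact h.norm_le _ (hn.subset (Finset.image_subset_image (hsub i)))
    _ = ∑ s ∈ I.biUnion Sf, g (σ n s) s := by
        refine (Finset.sum_biUnion fun i hi j hj hij => ?_).symm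
        refine Finset.disjoint_left.2 fun s hs hs' => hij ?_
        exact hI.eq_of_mem hi hj (Finset.mem_filter.1 hs).2 (Finset.mem_filter.1 hs').2
    _ ≤ ∑ s ∈ S', g (σ n s) s :=
        Finset.sum_le_sum_of_subset_of_nonneg (Finset.biUnion_subset.2 fun i _ => hsub i)
          fun s hs _ => hg s hs
    _ ≤ W := by
        rw [← sum_image_left (σ n) S' g]
        exact h.sum_le _ hn

lemma tendsto_jumpSum_nhdsGT (h : IsJumpGerm hT f Γ J g κ W) (t : Time T) :
    Tendsto (jumpSum J) (𝓝[>] t) (𝓝 (jumpSum J t)) := by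
  rw [Metric.tendsto_nhds]
  intro ε hε
  obtain ⟨D, -, -, -, hD⟩ := h.exists_finset (half_pos hε)
  have hev : ∀ᶠ v in 𝓝[>] t, ∀ s ∈ D, s ∉ Set.Ioc t v := by
    refine (D.eventually_all).2 fun s _ => ?_
    by_cases hs : t < s
    · filter_upwards [nhdsWithin_le_nhds (Iio_mem_nhds hs)] with v hv hmem
      exact absurd hmem.2 (not_le.2 hv)
    · exact Eventually.of_forall fun v hmem => hs hmem.1
  filter_upwards [hev, self_mem_nhdsWithin] with v hv htv
  have := norm_sub_sum_le hD (h.hasSum_jumpSum_sub (le_of_lt htv))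
  rw [Finset.sum_eq_zero fun s hs => Set.indicator_of_notMem (hv s hs) J, sub_zero] at this
  rw [dist_eq_norm]
  exact this.trans_lt (half_lt_self hε)

/-- The sums of the germ along partitions of vanishing mesh converge to the sum of the jumps. -/
theorem exists_meshLT (h : IsJumpGerm hT f Γ J g κ W) (t : Time T) {ε : ℝ} (hε : 0 < ε) :
    ∃ η : ℝ, 0 < η ∧ ∀ π : Partition (zeroTime hT) t, π.MeshLT η →
      ‖jumpSum J t - π.sum Γ‖ < ε := by
  classical
  have hε4 : 0 < ε / 4 := by positivity
  obtain ⟨D, η₀, hη₀, hI, hD⟩ := h.exists_finset hε4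
  let ε' := ε / 4 / (D.card + 1)
  have hε' : 0 < ε' := by positivity
  -- Intervals of length less than `δ s` around a jump time `s` carry nearly `J s`.
  have hloc : ∀ s : Time T, ∃ δ > 0, zeroTime hT < s → ∀ u v : Time T, u < s → s ≤ v →
      (v : ℝ) - u < δ → ‖Γ u v - J s‖ ≤ ε' := by
    intro s
    by_cases hs : zeroTime hT < s
    · have := Metric.tendsto_nhds.1 (h.tendsto s hs) ε' hε'
      rw [Filter.eventually_prod_iff] at this
      obtain ⟨pa, ha, pb, hb, hab⟩ := this
      obtain ⟨δ₁, h₁, H₁⟩ := Metric.mem_nhdsWithin_iff.1 ha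
      obtain ⟨δ₂, h₂, H₂⟩ := Metric.mem_nhdsWithin_iff.1 hb
      refine ⟨min δ₁ δ₂, lt_min h₁ h₂, fun _ u v hu hv huv => ?_⟩
      have hu' : (u : ℝ) < s := hu
      have hv' : (s : ℝ) ≤ v := hv
      have hua : pa u := H₁ ⟨by
        rw [Metric.mem_ball, Subtype.dist_eq, Real.dist_eq, abs_sub_comm, abs_of_pos (by linarith)]
        linarith [min_le_left δ₁ δ₂], hu⟩
      have hvb : pb v := H₂ ⟨by
        rw [Metric.mem_ball, Subtype.dist_eq, Real.dist_eq, abs_of_nonneg (by linarith)]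
        linarith [min_le_right δ₁ δ₂], hv⟩
      have := hab hua hvb
      rw [dist_eq_norm] at this
      exact this.le
    · exact ⟨1, one_pos, fun h' => absurd h' hs⟩
  choose δ hδ hΓ using hloc
  -- Intervals of length less than `δ' s s'` do not contain both `s` and `s'`.
  let δ' : Time T → Time T → ℝ := fun s s' => if s = s' then 1 else |(s : ℝ) - s'|
  have hδ' : ∀ s s', 0 < δ' s s' := fun s s' => by
    by_cases hs : s = s'
    · simp [δ', hs]
    · simp only [δ', hs, if_false, abs_pos, sub_ne_zero]
      exact fun h' => hs (Subtype.ext h')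
  have hexη : ∃ η > 0, η ≤ η₀ ∧ (∀ s ∈ D, η ≤ δ s) ∧ ∀ s ∈ D, ∀ s' ∈ D, η ≤ δ' s s' := by
    have hev : ∀ᶠ η in 𝓝[>] (0 : ℝ), η ≤ η₀ ∧ (∀ s ∈ D, η ≤ δ s) ∧
        ∀ s ∈ D, ∀ s' ∈ D, η ≤ δ' s s' := by
      have hle : ∀ {x : ℝ}, 0 < x → ∀ᶠ η in 𝓝[>] (0 : ℝ), η ≤ x := fun hx =>
        Filter.Eventually.mono (nhdsWithin_le_nhds (Iio_mem_nhds hx)) fun _ hy => le_of_lt hy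
      exact (hle hη₀).and (((D.eventually_all).2 fun s _ => hle (hδ s)).and
        ((D.eventually_all).2 fun s _ => (D.eventually_all).2 fun s' _ => hle (hδ' s s')))
    obtain ⟨η, hη, hη'⟩ := (hev.and self_mem_nhdsWithin).exists
    exact ⟨η, hη', hη⟩
  obtain ⟨η, hη, hηη₀, hηδ, hηδ'⟩ := hexη
  refine ⟨η, hη, fun π hπ => ?_⟩
  rw [π.sum_eq_sum_pairs]
  let Df : Time T × Time T → Finset (Time T) := fun i => D.filter (· ∈ Set.Ioc i.1 i.2)
  have hNO := π.nonOverlapping_pairs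
  -- The intervals without large jump.
  have hgood : ‖∑ i ∈ π.pairs.filter (fun i => Df i = ∅), Γ i.1 i.2‖ ≤ ε / 4 := by
    refine hI _ (hNO.subset (Finset.filter_subset _ _)) fun i hi => ?_
    obtain ⟨hiπ, hiD⟩ := Finset.mem_filter.1 hi
    refine ⟨(Partition.MeshLT.lt_of_mem_pairs hπ hiπ).trans_le hηη₀, fun s hs hmem => ?_⟩
    have : s ∈ Df i := Finset.mem_filter.2 ⟨hs, hmem⟩
    simp [hiD] at this
  have hdisj : (π.pairs : Set (Time T × Time T)).PairwiseDisjoint Df := fun i hi j hj hij =>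
    Finset.disjoint_left.2 fun s hs hs' => hij
      (hNO.eq_of_mem hi hj (Finset.mem_filter.1 hs).2 (Finset.mem_filter.1 hs').2)
  -- The large jumps in `(0, t]`, sorted according to the intervals which contain them.
  have hJ : ∑ s ∈ D, (Set.Iic t).indicator J s
      = ∑ i ∈ π.pairs.filter (fun i => ¬ Df i = ∅), ∑ s ∈ Df i, J s := by
    have h1 : ∑ i ∈ π.pairs, ∑ s ∈ Df i, J s
        = ∑ i ∈ π.pairs.filter (fun i => ¬ Df i = ∅), ∑ s ∈ Df i, J s := by
      rw [Finset.sum_filter]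
      refine Finset.sum_congr rfl fun i _ => ?_
      by_cases hi : Df i = ∅ <;> simp [hi]
    rw [← h1, ← Finset.sum_biUnion hdisj, Finset.sum_indicator_eq_sum_filter]
    refine (Finset.sum_subset ?_ fun s hs hns => ?_).symm
    · intro s hs
      obtain ⟨i, hi, hs⟩ := Finset.mem_biUnion.1 hs
      obtain ⟨hsD, hsi⟩ := Finset.mem_filter.1 hs
      exact Finset.mem_filter.2 ⟨hsD, hsi.2.trans (Partition.bounds_of_mem_pairs hi).2⟩
    · obtain ⟨hsD, hst⟩ := Finset.mem_filter.1 hs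
      rcases eq_or_lt_of_le (show zeroTime hT ≤ s from s.2.1) with h0 | h0
      · rw [← h0, h.zero]
      · obtain ⟨i, hi, hsi⟩ := π.exists_mem_pairs h0 hst
        exact absurd (Finset.mem_biUnion.2 ⟨i, hi, Finset.mem_filter.2 ⟨hsD, hsi⟩⟩) hns
  have hbad : ‖∑ i ∈ π.pairs.filter (fun i => ¬ Df i = ∅), (∑ s ∈ Df i, J s - Γ i.1 i.2)‖
      ≤ ε / 4 := by
    calc _ ≤ ∑ i ∈ π.pairs.filter (fun i => ¬ Df i = ∅), ((Df i).card : ℝ) * ε' := by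
          refine norm_sum_le_of_le _ fun i hi => ?_
          obtain ⟨hiπ, hne⟩ := Finset.mem_filter.1 hi
          have hlen := Partition.MeshLT.lt_of_mem_pairs hπ hiπ
          obtain ⟨s, hs⟩ := Finset.nonempty_iff_ne_empty.2 hne
          obtain ⟨hsD, hsi⟩ := Finset.mem_filter.1 hs
          have huniq : Df i = {s} := by
            refine Finset.eq_singleton_iff_unique_mem.2 ⟨hs, fun s' hs' => ?_⟩
            obtain ⟨hsD', hsi'⟩ := Finset.mem_filter.1 hs'
            by_contra hss
            have h1 := hηδ' s' hsD' s hsD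
            simp only [δ', hss, if_false] at h1
            have a1 : (i.1 : ℝ) < s := hsi.1
            have a2 : (s : ℝ) ≤ i.2 := hsi.2
            have a3 : (i.1 : ℝ) < s' := hsi'.1
            have a4 : (s' : ℝ) ≤ i.2 := hsi'.2
            rcases abs_cases ((s' : ℝ) - s) with ⟨h2, -⟩ | ⟨h2, -⟩ <;> linarith
          rw [huniq, Finset.sum_singleton, Finset.card_singleton, Nat.cast_one, one_mul,
            norm_sub_rev]
          exact hΓ s (lt_of_le_of_lt i.1.2.1 hsi.1) _ _ hsi.1 hsi.2 (hlen.trans_le (hηδ s hsD))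
      _ ≤ ∑ i ∈ π.pairs, ((Df i).card : ℝ) * ε' :=
          Finset.sum_le_sum_of_subset_of_nonneg (Finset.filter_subset _ _)
            fun _ _ _ => by positivity
      _ = (π.pairs.biUnion Df).card * ε' := by
          rw [Finset.card_biUnion hdisj, Nat.cast_sum, Finset.sum_mul]
      _ ≤ (D.card + 1) * ε' := by
          have : (π.pairs.biUnion Df).card ≤ D.card :=
            Finset.card_le_card (Finset.biUnion_subset.2 fun i _ => Finset.filter_subset _ _)
          have : ((π.pairs.biUnion Df).card : ℝ) ≤ D.card := by exact_mod_cast this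
          exact mul_le_mul_of_nonneg_right (by linarith) hε'.le
      _ = ε / 4 := by
          simp only [ε']
          field_simp
  have htail := norm_sub_sum_le hD (h.hasSum_jumpSum t)
  rw [hJ] at htail
  rw [← Finset.sum_filter_add_sum_filter_not π.pairs (fun i => Df i = ∅)]
  rw [Finset.sum_sub_distrib] at hbad
  set a := jumpSum J t
  set x := ∑ i ∈ π.pairs.filter (fun i => Df i = ∅), Γ i.1 i.2
  set y := ∑ i ∈ π.pairs.filter (fun i => ¬ Df i = ∅), Γ i.1 i.2
  set z := ∑ i ∈ π.pairs.filter (fun i => ¬ Df i = ∅), ∑ s ∈ Df i, J s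
  have : a - (x + y) = (a - z) - x + (z - y) := by abel
  rw [this]
  have h1 := norm_add_le ((a - z) - x) (z - y)
  have h2 := norm_sub_le (a - z) x
  linarith

end IsJumpGerm

/-! ### A martingale inequality in `L^m` for `m ≥ 2` -/

/-- The second order expansion of `|·|^m` with a remainder which is uniform in `x`. -/
lemma abs_add_rpow_le {m : ℝ} (hm : 2 ≤ m) (x y : ℝ) :
    |x + y| ^ m ≤ |x| ^ m + m * (|x| ^ (m - 2) * x * y)
      + (m ^ 2 + (m + 1) ^ m + m ^ m) * (|x| ^ (m - 2) * y ^ 2 + |y| ^ m) := by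
  have hm0 : 0 < m := by linarith
  have hA : 0 ≤ (m + 1) ^ m := by positivity
  have hB : 0 ≤ m ^ m := by positivity
  have hy : 0 ≤ |y| ^ m := by positivity
  have hxy : 0 ≤ |x| ^ (m - 2) * y ^ 2 := by positivity
  rcases le_or_gt (m * |y|) |x| with h | h
  · rcases eq_or_ne x 0 with rfl | hx
    · have : y = 0 := by
        rw [abs_zero] at h
        exact abs_nonpos_iff.1 (by nlinarith [abs_nonneg y])
      subst this
      simp [hm0.ne']
    have hx0 : 0 < |x| := abs_pos.2 hx
    set t := y / x
    have hy' : y = t * x := by simp only [t]; field_simp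
    have hmt : |m * t| ≤ 1 := by
      rw [abs_mul, abs_of_pos hm0, abs_div, ← mul_div_assoc, div_le_one hx0]
      exact h
    have ht : -1 ≤ t := by
      have h1 := (abs_le.1 hmt).1
      by_contra! hlt
      nlinarith
    have h1 : |1 + t| ^ m ≤ 1 + m * t + (m * t) ^ 2 := by
      rw [abs_of_nonneg (by linarith)]
      calc (1 + t) ^ m ≤ (Real.exp t) ^ m :=
            Real.rpow_le_rpow (by linarith) (by linarith [Real.add_one_le_exp t]) hm0.le
        _ = Real.exp (m * t) := by rw [← Real.exp_mul, mul_comm]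
        _ ≤ 1 + m * t + (m * t) ^ 2 := by
            have := (abs_le.1 (Real.abs_exp_sub_one_sub_id_le hmt)).2
            linarith
    have h2 : |x| ^ m = |x| ^ (m - 2) * x ^ 2 := by
      rw [← sq_abs x, ← Real.rpow_natCast, ← Real.rpow_add hx0]
      norm_num
    have h3 : |x + y| ^ m = |x| ^ m * |1 + t| ^ m := by
      rw [← Real.mul_rpow (abs_nonneg _) (abs_nonneg _), ← abs_mul]
      congr 2
      rw [hy']
      ring
    calc |x + y| ^ m ≤ |x| ^ m * (1 + m * t + (m * t) ^ 2) := by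
          rw [h3]
          exact mul_le_mul_of_nonneg_left h1 (by positivity)
      _ = |x| ^ m + m * (|x| ^ (m - 2) * x * y) + m ^ 2 * (|x| ^ (m - 2) * y ^ 2) := by
          rw [h2, hy']
          ring
      _ ≤ _ := by nlinarith [mul_nonneg (add_nonneg hA hB) hxy,
            mul_nonneg (add_nonneg (add_nonneg (sq_nonneg m) hA) hB) hy]
  · have h1 : |x + y| ^ m ≤ (m + 1) ^ m * |y| ^ m := by
      rw [← Real.mul_rpow (by linarith) (abs_nonneg _)]
      refine Real.rpow_le_rpow (abs_nonneg _) ?_ hm0.le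
      linarith [abs_add_le x y]
    have h2 : -(m * (|x| ^ (m - 2) * x * y)) ≤ m ^ m * |y| ^ m := by
      have h3 : |x| ^ (m - 2) * |x| ≤ (m * |y|) ^ (m - 1) := by
        rw [← Real.rpow_add_one' (abs_nonneg _) (by linarith), show m - 2 + 1 = m - 1 by ring]
        exact Real.rpow_le_rpow (abs_nonneg _) h.le (by linarith)
      calc -(m * (|x| ^ (m - 2) * x * y)) ≤ |m * (|x| ^ (m - 2) * x * y)| := neg_le_abs _
        _ = |x| ^ (m - 2) * |x| * (m * |y|) := by
            rw [abs_mul, abs_mul, abs_mul, abs_of_pos hm0,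
              abs_of_nonneg (show 0 ≤ |x| ^ (m - 2) by positivity)]
            ring
        _ ≤ (m * |y|) ^ (m - 1) * (m * |y|) := by gcongr
        _ = m ^ m * |y| ^ m := by
            rw [← Real.rpow_add_one' (by positivity) (by linarith), sub_add_cancel,
              Real.mul_rpow hm0.le (abs_nonneg _)]
    have hx : 0 ≤ |x| ^ m := by positivity
    nlinarith [mul_nonneg (add_nonneg (add_nonneg (sq_nonneg m) hA) hB) hxy,
      mul_nonneg (sq_nonneg m) hy]

lemma rpow_le_sq_add_rpow {m : ℝ} (hm : 2 ≤ m) {a b c : ℝ} (ha : 0 ≤ a) (hb : 0 ≤ b)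
    (hc : 1 ≤ c) :
    a ^ m + c * (a ^ (m - 2) * b ^ 2 + b ^ m) ≤ (a ^ 2 + 2 * c * b ^ 2) ^ (m / 2) := by
  have hc0 : 0 < c := by linarith
  have hsq : ∀ {x : ℝ}, 0 ≤ x → (x ^ 2) ^ (m / 2 - 1) = x ^ (m - 2) := fun hx => by
    rw [← Real.rpow_natCast, ← Real.rpow_mul hx]
    congr 1
    push_cast
    ring
  have hadd : ∀ {x : ℝ}, 0 ≤ x → x ^ (m - 2) * x ^ 2 = x ^ m := fun {x} hx => by
    rw [← Real.rpow_natCast, ← Real.rpow_add' hx (by push_cast; linarith)]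
    norm_num
  set s := 2 * c * b ^ 2 with hs
  have hs0 : 0 ≤ s := by positivity
  have hz : (a ^ 2 + s) ^ (m / 2) = (a ^ 2 + s) ^ (m / 2 - 1) * (a ^ 2 + s) := by
    rw [← Real.rpow_add_one' (by positivity) (by linarith), sub_add_cancel]
  have h1 : a ^ (m - 2) ≤ (a ^ 2 + s) ^ (m / 2 - 1) := by
    rw [← hsq ha]
    exact Real.rpow_le_rpow (by positivity) (by linarith) (by linarith)
  have h2 : b ^ (m - 2) ≤ (a ^ 2 + s) ^ (m / 2 - 1) := by
    rw [← hsq hb]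
    exact Real.rpow_le_rpow (by positivity) (by nlinarith [sq_nonneg b, sq_nonneg a])
      (by linarith)
  have h3 := mul_le_mul_of_nonneg_right h1 (sq_nonneg a)
  have h4 := mul_le_mul_of_nonneg_right h1 (show 0 ≤ c * b ^ 2 by positivity)
  have h5 := mul_le_mul_of_nonneg_right h2 (show 0 ≤ c * b ^ 2 by positivity)
  rw [hadd ha] at h3
  rw [hz, ← hadd hb]
  calc a ^ m + c * (a ^ (m - 2) * b ^ 2 + b ^ (m - 2) * b ^ 2)
      = a ^ m + a ^ (m - 2) * (c * b ^ 2) + b ^ (m - 2) * (c * b ^ 2) := by ring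
    _ ≤ _ := add_le_add (add_le_add h3 h4) h5
    _ = _ := by rw [hs]; ring

section MartingaleInequality

variable {Ω : Type*} {mΩ : MeasurableSpace Ω} {P : Measure Ω}

lemma toReal_eLpNorm_rpow {A : Type*} [NormedAddCommGroup A] {m : ℝ} (hm : 0 < m) {f : Ω → A}
    (hf : MemLp f (ENNReal.ofReal m) P) :
    (eLpNorm f (ENNReal.ofReal m) P).toReal ^ m = ∫ ω, ‖f ω‖ ^ m ∂P := by
  have h0 : 0 ≤ ∫ ω, ‖f ω‖ ^ m ∂P := integral_nonneg fun ω => by positivity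
  rw [hf.eLpNorm_eq_integral_rpow_norm (by simpa using hm) ENNReal.ofReal_ne_top,
    ENNReal.toReal_ofReal hm.le, ENNReal.toReal_ofReal (by positivity), ← Real.rpow_mul h0,
    inv_mul_cancel₀ hm.ne', Real.rpow_one]

lemma integrable_norm_rpow_ofReal {A : Type*} [NormedAddCommGroup A] {m : ℝ} (hm : 0 < m)
    {f : Ω → A} (hf : MemLp f (ENNReal.ofReal m) P) : Integrable (fun ω => ‖f ω‖ ^ m) P := by
  have := hf.integrable_norm_rpow (by simpa using hm) ENNReal.ofReal_ne_top
  rwa [ENNReal.toReal_ofReal hm.le] at this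

lemma abs_rpow_mul_abs_rpow_le {m α β : ℝ} (hα : 0 ≤ α) (hβ : 0 ≤ β) (h : α + β = m)
    (hm : 0 < m) (x y : ℝ) : |x| ^ α * |y| ^ β ≤ |x| ^ m + |y| ^ m := by
  have hx := abs_nonneg x
  have hy := abs_nonneg y
  rcases le_total |x| |y| with hxy | hxy
  · calc |x| ^ α * |y| ^ β ≤ |y| ^ α * |y| ^ β := by gcongr
      _ = |y| ^ m := by rw [← Real.rpow_add' hy (by rw [h]; exact hm.ne'), h]
      _ ≤ _ := by linarith [Real.rpow_nonneg hx m]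
  · calc |x| ^ α * |y| ^ β ≤ |x| ^ α * |x| ^ β := by gcongr
      _ = |x| ^ m := by rw [← Real.rpow_add' hx (by rw [h]; exact hm.ne'), h]
      _ ≤ _ := by linarith [Real.rpow_nonneg hy m]

/-- Adding to `f` an increment `g` which is orthogonal to `|f|^{m-2} f` costs only the square of the
norm of `g`. -/
lemma sq_eLpNorm_add_le {m : ℝ} (hm : 2 ≤ m) {f g : Ω → ℝ}
    (hf : MemLp f (ENNReal.ofReal m) P) (hg : MemLp g (ENNReal.ofReal m) P)
    (hfg : ∫ ω, |f ω| ^ (m - 2) * f ω * g ω ∂P = 0) :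
    (eLpNorm (fun ω => f ω + g ω) (ENNReal.ofReal m) P).toReal ^ 2 ≤
      (eLpNorm f (ENNReal.ofReal m) P).toReal ^ 2
        + 2 * (m ^ 2 + (m + 1) ^ m + m ^ m) * (eLpNorm g (ENNReal.ofReal m) P).toReal ^ 2 := by
  have hm0 : 0 < m := by linarith
  set c := m ^ 2 + (m + 1) ^ m + m ^ m
  have hc : 1 ≤ c := by
    have : 0 ≤ (m + 1) ^ m := by positivity
    have : 0 ≤ m ^ m := by positivity
    simp only [c]
    nlinarith
  set a := (eLpNorm f (ENNReal.ofReal m) P).toReal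
  set b := (eLpNorm g (ENNReal.ofReal m) P).toReal
  have ha : 0 ≤ a := ENNReal.toReal_nonneg
  have hb : 0 ≤ b := ENNReal.toReal_nonneg
  have hfm : AEMeasurable f P := hf.1.aemeasurable
  have hgm : AEMeasurable g P := hg.1.aemeasurable
  have hfi := integrable_norm_rpow_ofReal hm0 hf
  have hgi := integrable_norm_rpow_ofReal hm0 hg
  simp only [Real.norm_eq_abs] at hfi hgi
  have hint1 : Integrable (fun ω => |f ω| ^ (m - 2) * f ω * g ω) P := by
    refine (hfi.add hgi).mono' (by fun_prop) (Eventually.of_forall fun ω => ?_)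
    rw [Real.norm_eq_abs, abs_mul, abs_mul,
      abs_of_nonneg (show 0 ≤ |f ω| ^ (m - 2) by positivity),
      ← Real.rpow_add_one' (abs_nonneg _) (by linarith), show m - 2 + 1 = m - 1 by ring]
    simpa using abs_rpow_mul_abs_rpow_le (m := m) (α := m - 1) (β := 1) (by linarith)
      zero_le_one (by ring) hm0 (f ω) (g ω)
  have hint2 : Integrable (fun ω => |f ω| ^ (m - 2) * g ω ^ 2) P := by
    refine (hfi.add hgi).mono' (by fun_prop) (Eventually.of_forall fun ω => ?_)
    rw [Real.norm_eq_abs, abs_of_nonneg (by positivity), ← sq_abs (g ω)]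
    simpa using abs_rpow_mul_abs_rpow_le (m := m) (α := m - 2) (β := 2) (by linarith)
      zero_le_two (by ring) hm0 (f ω) (g ω)
  have hint3 : Integrable (fun ω => c * (|f ω| ^ (m - 2) * g ω ^ 2 + |g ω| ^ m)) P :=
    (hint2.add hgi).const_mul c
  have hholder : ∫ ω, |f ω| ^ (m - 2) * g ω ^ 2 ∂P ≤ a ^ (m - 2) * b ^ 2 := by
    have h1 := ENNReal.lintegral_mul_norm_pow_le (μ := P)
      (f := fun ω => ENNReal.ofReal (|f ω| ^ m)) (g := fun ω => ENNReal.ofReal (|g ω| ^ m))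
      (by fun_prop) (by fun_prop) (p := (m - 2) / m) (q := 2 / m)
      (by apply div_nonneg <;> linarith) (by positivity) (by field_simp; ring)
    have e1 : ∀ x : ℝ, ∀ α : ℝ, 0 ≤ α →
        (ENNReal.ofReal (|x| ^ m)) ^ (α / m) = ENNReal.ofReal (|x| ^ α) := fun x α hα => by
      rw [ENNReal.ofReal_rpow_of_nonneg (by positivity) (by positivity),
        ← Real.rpow_mul (abs_nonneg _), mul_div_cancel₀ _ hm0.ne']
    have e2 : ∀ h : Ω → ℝ, Integrable (fun ω => |h ω| ^ m) P →
        ∫⁻ ω, ENNReal.ofReal (|h ω| ^ m) ∂P = ENNReal.ofReal (∫ ω, |h ω| ^ m ∂P) :=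
      fun h hi => (ofReal_integral_eq_lintegral_ofReal hi
        (Eventually.of_forall fun ω => by positivity)).symm
    have ef : ∫ ω, |f ω| ^ m ∂P = a ^ m := (toReal_eLpNorm_rpow hm0 hf).symm
    have eg : ∫ ω, |g ω| ^ m ∂P = b ^ m := (toReal_eLpNorm_rpow hm0 hg).symm
    have e3 : ∀ x : ℝ, 0 ≤ x → ∀ α : ℝ, 0 ≤ α →
        (ENNReal.ofReal (x ^ m)) ^ (α / m) = ENNReal.ofReal (x ^ α) := fun x hx α hα => by
      simpa [abs_of_nonneg hx] using e1 x α hα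
    rw [e2 f hfi, e2 g hgi, ef, eg, e3 a ha _ (by linarith), e3 b hb _ (by norm_num),
      ← ENNReal.ofReal_mul (by positivity)] at h1
    rw [lintegral_congr (g := fun ω => ENNReal.ofReal (|f ω| ^ (m - 2) * g ω ^ 2)) (fun ω => by
      rw [e1 _ _ (by linarith), e1 _ _ (by norm_num), ← ENNReal.ofReal_mul (by positivity)]
      norm_num),
      ← ofReal_integral_eq_lintegral_ofReal hint2 (Eventually.of_forall fun ω => by
        positivity)] at h1
    have := (ENNReal.ofReal_le_ofReal_iff (by positivity)).1 h1
    simpa using this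
  have key : (eLpNorm (fun ω => f ω + g ω) (ENNReal.ofReal m) P).toReal ^ m
      ≤ (a ^ 2 + 2 * c * b ^ 2) ^ (m / 2) := by
    refine le_trans ?_ (rpow_le_sq_add_rpow hm ha hb hc)
    refine (toReal_eLpNorm_rpow hm0 (hf.add hg)).trans_le ?_
    change ∫ ω, ‖f ω + g ω‖ ^ m ∂P ≤ _
    calc ∫ ω, ‖f ω + g ω‖ ^ m ∂P
        ≤ ∫ ω, (|f ω| ^ m + m * (|f ω| ^ (m - 2) * f ω * g ω)
            + c * (|f ω| ^ (m - 2) * g ω ^ 2 + |g ω| ^ m)) ∂P :=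
          integral_mono (integrable_norm_rpow_ofReal hm0 (hf.add hg))
            ((hfi.add (hint1.const_mul m)).add hint3)
            fun ω => abs_add_rpow_le hm (f ω) (g ω)
      _ = a ^ m + c * (∫ ω, |f ω| ^ (m - 2) * g ω ^ 2 ∂P + b ^ m) := by
          rw [integral_add (f := fun ω => |f ω| ^ m + m * (|f ω| ^ (m - 2) * f ω * g ω))
              (hfi.add (hint1.const_mul m)) hint3,
            integral_add hfi (hint1.const_mul m), integral_const_mul, integral_const_mul,
            integral_add hint2 hgi, hfg, mul_zero, add_zero]
          congr 1
          · exact (toReal_eLpNorm_rpow hm0 hf).symm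
          · congr 2
            exact (toReal_eLpNorm_rpow hm0 hg).symm
      _ ≤ _ := by gcongr
  have h2 : 0 ≤ a ^ 2 + 2 * c * b ^ 2 := by positivity
  set n := (eLpNorm (fun ω => f ω + g ω) (ENNReal.ofReal m) P).toReal
  have hn : 0 ≤ n := ENNReal.toReal_nonneg
  rw [show n ^ m = (n ^ 2) ^ (m / 2) by
    rw [← Real.rpow_natCast, ← Real.rpow_mul hn]; congr 1; push_cast; ring] at key
  exact (Real.rpow_le_rpow_iff (by positivity) h2 (by positivity)).1 key

variable {ι : Type*} [LinearOrder ι] {ℱ : Filtration ι mΩ}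

/-- Real martingale differences over a family of intervals have type `2` in `L^m`. -/
lemma sq_eLpNorm_sum_le [IsFiniteMeasure P] {m : ℝ} (hm : 2 ≤ m) (d : ι → ι → Ω → ℝ)
    {I : Finset (ι × ι)} (hI : NonOverlapping I)
    (hd : ∀ i ∈ I, MemLp (d i.1 i.2) (ENNReal.ofReal m) P)
    (hmeas : ∀ i ∈ I, StronglyMeasurable[ℱ i.2] (d i.1 i.2))
    (hcond : ∀ i ∈ I, P[d i.1 i.2 | ℱ i.1] =ᵐ[P] 0) :
    (eLpNorm (fun ω => ∑ i ∈ I, d i.1 i.2 ω) (ENNReal.ofReal m) P).toReal ^ 2 ≤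
      2 * (m ^ 2 + (m + 1) ^ m + m ^ m) *
        ∑ i ∈ I, (eLpNorm (d i.1 i.2) (ENNReal.ofReal m) P).toReal ^ 2 := by
  classical
  induction I using Finset.induction_on_max_value (Prod.fst : ι × ι → ι) with
  | empty => simp
  | insert a s has hmax ih =>
    have hs : ∀ i ∈ s, i ∈ insert a s := fun i hi => Finset.mem_insert_of_mem hi
    have ih' := ih (hI.subset (Finset.subset_insert a s)) (fun i hi => hd i (hs i hi))
      (fun i hi => hmeas i (hs i hi)) (fun i hi => hcond i (hs i hi))
    have ha := Finset.mem_insert_self a s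
    have hle : ∀ i ∈ s, i.2 ≤ a.1 := fun i hi =>
      (hI.sep i (hs i hi) a ha (fun h => has (h ▸ hi))).resolve_right
        fun h => absurd (h.trans (hmax i hi)) (not_le.2 (hI.lt a ha))
    set S : Ω → ℝ := fun ω => ∑ i ∈ s, d i.1 i.2 ω
    have hSmeas : StronglyMeasurable[ℱ a.1] S :=
      Finset.stronglyMeasurable_fun_sum _ fun i hi =>
        (hmeas i (hs i hi)).mono (ℱ.mono (hle i hi))
    have hSL : MemLp S (ENNReal.ofReal m) P :=
      memLp_finsetSum _ fun i hi => hd i (hs i hi)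
    have hdL := hd a ha
    have hh : StronglyMeasurable[ℱ a.1] (fun ω => |S ω| ^ (m - 2) * S ω) :=
      ((continuous_abs.rpow_const fun _ => Or.inr (by linarith)).mul
        continuous_id).comp_stronglyMeasurable hSmeas
    have hdi : Integrable (d a.1 a.2) P := hdL.integrable (by
      rw [← ENNReal.ofReal_one]
      exact ENNReal.ofReal_le_ofReal (by linarith))
    have hm0 : 0 < m := by linarith
    have hSm : AEMeasurable S P := hSL.1.aemeasurable
    have hdm : AEMeasurable (d a.1 a.2) P := hdL.1.aemeasurable
    have hint : Integrable ((fun ω => |S ω| ^ (m - 2) * S ω) * d a.1 a.2) P := by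
      have hfi := integrable_norm_rpow_ofReal hm0 hSL
      have hgi := integrable_norm_rpow_ofReal hm0 hdL
      refine (hfi.add hgi).mono' (by
        change AEStronglyMeasurable (fun ω => |S ω| ^ (m - 2) * S ω * d a.1 a.2 ω) P
        fun_prop) (Eventually.of_forall fun ω => ?_)
      rw [Pi.mul_apply, Real.norm_eq_abs, abs_mul, abs_mul,
        abs_of_nonneg (show 0 ≤ |S ω| ^ (m - 2) by positivity),
        ← Real.rpow_add_one' (abs_nonneg _) (by linarith), show m - 2 + 1 = m - 1 by ring]
      simpa using abs_rpow_mul_abs_rpow_le (m := m) (α := m - 1) (β := 1) (by linarith)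
        zero_le_one (by ring) hm0 (S ω) (d a.1 a.2 ω)
    have hzero : ∫ ω, |S ω| ^ (m - 2) * S ω * d a.1 a.2 ω ∂P = 0 := by
      have h1 := condExp_mul_of_stronglyMeasurable_left hh hint hdi
      have h2 := integral_condExp (ℱ.le a.1) (μ := P)
        (f := (fun ω => |S ω| ^ (m - 2) * S ω) * d a.1 a.2)
      rw [show (fun ω => |S ω| ^ (m - 2) * S ω * d a.1 a.2 ω)
        = (fun ω => |S ω| ^ (m - 2) * S ω) * d a.1 a.2 from rfl, ← h2]
      refine integral_eq_zero_of_ae ?_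
      filter_upwards [h1, hcond a ha] with ω h1 h2
      rw [h1, Pi.mul_apply, h2, Pi.zero_apply, mul_zero]
    have hstep := sq_eLpNorm_add_le hm hSL hdL hzero
    rw [Finset.sum_insert has, mul_add]
    have heq : (fun ω => ∑ i ∈ insert a s, d i.1 i.2 ω) = fun ω => S ω + d a.1 a.2 ω := by
      funext ω
      rw [Finset.sum_insert has, add_comm]
    rw [heq]
    linarith

/-- Martingale differences in a finite-dimensional space have type `2` in `L^m`, `m ≥ 2`: the real
case applies to every coordinate. -/
theorem exists_eLpNorm_sum_le (G : Type*) [NormedAddCommGroup G] [NormedSpace ℝ G]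
    [FiniteDimensional ℝ G] [CompleteSpace G] [IsFiniteMeasure P] (ℱ : Filtration ι mΩ) {m : ℝ}
    (hm : 2 ≤ m) :
    ∃ C : ℝ, 0 ≤ C ∧ ∀ (d : ι → ι → Ω → G) (I : Finset (ι × ι)), NonOverlapping I →
      (∀ i ∈ I, MemLp (d i.1 i.2) (ENNReal.ofReal m) P) →
      (∀ i ∈ I, StronglyMeasurable[ℱ i.2] (d i.1 i.2)) →
      (∀ i ∈ I, P[d i.1 i.2 | ℱ i.1] =ᵐ[P] 0) →
      (eLpNorm (fun ω => ∑ i ∈ I, d i.1 i.2 ω) (ENNReal.ofReal m) P).toReal ≤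
        C * √(∑ i ∈ I, (eLpNorm (d i.1 i.2) (ENNReal.ofReal m) P).toReal ^ 2) := by
  let b := Module.finBasis ℝ G
  let ℓ : Fin (Module.finrank ℝ G) → G →L[ℝ] ℝ := fun k => (b.coord k).toContinuousLinearMap
  have hm1 : (1 : ℝ≥0∞) ≤ ENNReal.ofReal m := by
    rw [← ENNReal.ofReal_one]
    exact ENNReal.ofReal_le_ofReal (by linarith)
  have hc0 : 0 ≤ 2 * (m ^ 2 + (m + 1) ^ m + m ^ m) := by positivity
  set c := 2 * (m ^ 2 + (m + 1) ^ m + m ^ m)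
  refine ⟨∑ k, ‖b k‖ * (√c * ‖ℓ k‖), by positivity, fun d I hI hd hmeas hcond => ?_⟩
  have hreal : ∀ k, (eLpNorm (fun ω => ∑ i ∈ I, ℓ k (d i.1 i.2 ω)) (ENNReal.ofReal m) P).toReal
      ≤ √c * ‖ℓ k‖ * √(∑ i ∈ I, (eLpNorm (d i.1 i.2) (ENNReal.ofReal m) P).toReal ^ 2) := by
    intro k
    have h1 := sq_eLpNorm_sum_le hm (fun u v ω => ℓ k (d u v ω)) (ℱ := ℱ) (P := P) hI
      (fun i hi => (ℓ k).comp_memLp' (hd i hi))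
      (fun i hi => (ℓ k).continuous.comp_stronglyMeasurable (hmeas i hi))
      (fun i hi => by
        filter_upwards [(ℓ k).comp_condExp_comm (m := ℱ i.1) ((hd i hi).integrable hm1),
          hcond i hi] with ω h1 h2
        have h3 : (P[ℓ k ∘ d i.1 i.2 | ℱ i.1]) ω = 0 := by
          rw [← h1, Function.comp_apply, h2]
          simp
        exact h3)
    have h2 : ∀ i ∈ I, (eLpNorm (fun ω => ℓ k (d i.1 i.2 ω)) (ENNReal.ofReal m) P).toReal ^ 2
        ≤ ‖ℓ k‖ ^ 2 * (eLpNorm (d i.1 i.2) (ENNReal.ofReal m) P).toReal ^ 2 := by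
      intro i hi
      rw [← mul_pow]
      refine pow_le_pow_left₀ ENNReal.toReal_nonneg ?_ 2
      have h3 := eLpNorm_le_mul_eLpNorm_of_ae_le_mul (μ := P) (f := fun ω => ℓ k (d i.1 i.2 ω))
        (g := d i.1 i.2) (c := ‖ℓ k‖) (Eventually.of_forall fun ω => (ℓ k).le_opNorm _)
        (ENNReal.ofReal m)
      have h4 := ENNReal.toReal_mono (ENNReal.mul_ne_top ENNReal.ofReal_ne_top (hd i hi).2.ne) h3
      rwa [ENNReal.toReal_mul, ENNReal.toReal_ofReal (norm_nonneg _)] at h4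
    have h3 := h1.trans (mul_le_mul_of_nonneg_left (Finset.sum_le_sum h2) hc0)
    rw [← Finset.mul_sum] at h3
    have h4 := Real.le_sqrt_of_sq_le h3
    rwa [Real.sqrt_mul hc0, Real.sqrt_mul (sq_nonneg _), Real.sqrt_sq (norm_nonneg _),
      ← mul_assoc] at h4
  have hdecomp : (fun ω => ∑ i ∈ I, d i.1 i.2 ω)
      = fun ω => ∑ k, (∑ i ∈ I, ℓ k (d i.1 i.2 ω)) • b k := by
    funext ω
    have h1 : ∀ k, ∑ i ∈ I, ℓ k (d i.1 i.2 ω) = b.repr (∑ i ∈ I, d i.1 i.2 ω) k := fun k =>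
      (map_sum (ℓ k) _ _).symm
    simp only [h1]
    exact (b.sum_repr _).symm
  have hLk : ∀ k, MemLp (fun ω => ∑ i ∈ I, ℓ k (d i.1 i.2 ω)) (ENNReal.ofReal m) P := fun k =>
    memLp_finsetSum _ fun i hi => (ℓ k).comp_memLp' (hd i hi)
  rw [hdecomp]
  have hsum : eLpNorm (fun ω => ∑ k, (∑ i ∈ I, ℓ k (d i.1 i.2 ω)) • b k) (ENNReal.ofReal m) P
      ≤ ∑ k, eLpNorm (fun ω => (∑ i ∈ I, ℓ k (d i.1 i.2 ω)) • b k) (ENNReal.ofReal m) P := by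
    have := eLpNorm_sum_le (μ := P) (p := ENNReal.ofReal m) (s := Finset.univ)
      (f := fun k ω => (∑ i ∈ I, ℓ k (d i.1 i.2 ω)) • b k)
      (fun k _ => (hLk k).1.smul_const (b k)) hm1
    convert this using 2
    funext ω
    simp
  have hk : ∀ k, eLpNorm (fun ω => (∑ i ∈ I, ℓ k (d i.1 i.2 ω)) • b k) (ENNReal.ofReal m) P
      ≤ ENNReal.ofReal ‖b k‖ * eLpNorm (fun ω => ∑ i ∈ I, ℓ k (d i.1 i.2 ω))
        (ENNReal.ofReal m) P := fun k =>
    eLpNorm_le_mul_eLpNorm_of_ae_le_mul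
      (Eventually.of_forall fun ω => by rw [norm_smul, mul_comm]) _
  have hfin : ∀ k ∈ Finset.univ, ENNReal.ofReal ‖b k‖ *
      eLpNorm (fun ω => ∑ i ∈ I, ℓ k (d i.1 i.2 ω)) (ENNReal.ofReal m) P ≠ ∞ := fun k _ =>
    ENNReal.mul_ne_top ENNReal.ofReal_ne_top (hLk k).2.ne
  have h5 := ENNReal.toReal_mono (ENNReal.sum_ne_top.2 hfin)
    (hsum.trans (Finset.sum_le_sum fun k _ => hk k))
  rw [ENNReal.toReal_sum hfin] at h5
  refine h5.trans ?_
  rw [Finset.sum_mul]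
  refine Finset.sum_le_sum fun k _ => ?_
  rw [ENNReal.toReal_mul, ENNReal.toReal_ofReal (norm_nonneg _), mul_assoc ‖b k‖]
  exact mul_le_mul_of_nonneg_left (hreal k) (norm_nonneg _)

end MartingaleInequality

/-! ### Germs with a martingale part and a Young part -/

section Young

variable {ι : Type*} {I : Finset ι} {p c e : ℝ} {a x ρ : ι → ℝ}

/-- The square function of the martingale part: since `p < 4`, powers of the two factors can be
spared. -/
lemma sum_sq_mul_sq_le (hp : 0 < p) (hp4 : p < 4) (ha : ∀ i ∈ I, 0 ≤ a i)
    (hx : ∀ i ∈ I, 0 ≤ x i) (hac : ∀ i ∈ I, a i ≤ c) (hxe : ∀ i ∈ I, x i ≤ e) :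
    ∑ i ∈ I, a i ^ 2 * x i ^ 2
      ≤ c ^ (2 - p / 2) * e ^ (2 - p / 2) * ∑ i ∈ I, (a i ^ p + x i ^ p) := by
  rw [Finset.mul_sum]
  refine Finset.sum_le_sum fun i hi => ?_
  have h0 := ha i hi
  have h1 := hx i hi
  have hc := h0.trans (hac i hi)
  have he := h1.trans (hxe i hi)
  have hsplit : ∀ {y : ℝ}, 0 ≤ y → y ^ 2 = y ^ (2 - p / 2) * y ^ (p / 2) := fun hy => by
    rw [← Real.rpow_add' hy (by linarith), sub_add_cancel]
    norm_num
  have h2 := abs_rpow_mul_abs_rpow_le (m := p) (α := p / 2) (β := p / 2) (by positivity)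
    (by positivity) (by ring) hp (a i) (x i)
  rw [abs_of_nonneg h0, abs_of_nonneg h1] at h2
  calc a i ^ 2 * x i ^ 2
      = (a i ^ (2 - p / 2) * x i ^ (2 - p / 2)) * (a i ^ (p / 2) * x i ^ (p / 2)) := by
        rw [hsplit h0, hsplit h1]
        ring
    _ ≤ (c ^ (2 - p / 2) * e ^ (2 - p / 2)) * (a i ^ p + x i ^ p) := by
        have h4 : 0 ≤ 2 - p / 2 := by linarith
        gcongr
        exacts [hac i hi, hxe i hi]

/-- The Young sum: since `1 / p + 2 / p > 1`, powers of the two factors can be spared. -/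
lemma sum_mul_le (hp : 0 < p) (hp3 : p < 3) (he : 0 ≤ e) (ha : ∀ i ∈ I, 0 ≤ a i)
    (hρ : ∀ i ∈ I, 0 ≤ ρ i) (hac : ∀ i ∈ I, a i ≤ c) (hρe : ∀ i ∈ I, ρ i ≤ e ^ 2) :
    ∑ i ∈ I, a i * ρ i
      ≤ c ^ (1 - p / 3) * e ^ (2 - 2 * p / 3) * ∑ i ∈ I, (a i ^ p + ρ i ^ (p / 2)) := by
  rw [Finset.mul_sum]
  refine Finset.sum_le_sum fun i hi => ?_
  have h0 := ha i hi
  have h1 := hρ i hi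
  have hc := h0.trans (hac i hi)
  have hsplit : ∀ {y : ℝ}, 0 ≤ y → y = y ^ (1 - p / 3) * y ^ (p / 3) := fun {y} hy => by
    rw [← Real.rpow_add' hy (by linarith), sub_add_cancel, Real.rpow_one]
  have h2 := abs_rpow_mul_abs_rpow_le (m := p) (α := p / 3) (β := 2 * p / 3) (by positivity)
    (by positivity) (by ring) hp (a i) (√(ρ i))
  have hsqrt : ∀ α : ℝ, (√(ρ i)) ^ α = ρ i ^ (α / 2) := fun α => by
    rw [Real.sqrt_eq_rpow, ← Real.rpow_mul h1]
    congr 1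
    ring
  rw [abs_of_nonneg h0, abs_of_nonneg (Real.sqrt_nonneg _), hsqrt, hsqrt,
    show 2 * p / 3 / 2 = p / 3 by ring] at h2
  have h3 : ρ i ^ (1 - p / 3) ≤ e ^ (2 - 2 * p / 3) := by
    calc ρ i ^ (1 - p / 3) ≤ (e ^ 2) ^ (1 - p / 3) :=
          Real.rpow_le_rpow h1 (hρe i hi) (by linarith)
      _ = e ^ (2 - 2 * p / 3) := by
          rw [← Real.rpow_natCast, ← Real.rpow_mul he]
          congr 1
          push_cast
          ring
  calc a i * ρ i
      = (a i ^ (1 - p / 3) * ρ i ^ (1 - p / 3)) * (a i ^ (p / 3) * ρ i ^ (p / 3)) := by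
        conv_lhs => rw [hsplit h0, hsplit h1]
        ring
    _ ≤ (c ^ (1 - p / 3) * e ^ (2 - 2 * p / 3)) * (a i ^ p + ρ i ^ (p / 2)) := by
        have h4 : 0 ≤ 1 - p / 3 := by linarith
        have h5 := hac i hi
        gcongr

end Young

/-- A germ whose sums are bounded by the square function of a product of two paths of finite
`p`-variation and by a Young sum with a remainder of finite `p/2`-variation. The decisive point is
that these bounds vanish with the size of the increments of the first path alone. -/
theorem IsJumpGerm.of_norm_sum_le {T : ℝ} {A H : Type*} [MetricSpace A] [NormedAddCommGroup H]
    {hT : 0 < T} {f : Time T → A} {Γ : Time T → Time T → H} {J : Time T → H} {p : ℝ}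
    (hp : 0 < p) (hp3 : p < 3) {x ρ : Time T → Time T → ℝ} (hx : ∀ u v, 0 ≤ x u v)
    (hρ : ∀ u v, 0 ≤ ρ u v) {W₁ W₂ W₃ C₁ C₂ : ℝ} (hC₁ : 0 ≤ C₁) (hC₂ : 0 ≤ C₂)
    (hcadlag : IsCadlag f) (hzero : J (zeroTime hT) = 0)
    (htendsto : ∀ s, zeroTime hT < s →
      Tendsto (fun i : Time T × Time T => Γ i.1 i.2) (𝓝[<] s ×ˢ 𝓝[≥] s) (𝓝 (J s)))
    (hW₁ : ∀ I : Finset (Time T × Time T), NonOverlapping I →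
      ∑ i ∈ I, dist (f i.1) (f i.2) ^ p ≤ W₁)
    (hW₂ : ∀ I : Finset (Time T × Time T), NonOverlapping I → ∑ i ∈ I, x i.1 i.2 ^ p ≤ W₂)
    (hW₃ : ∀ I : Finset (Time T × Time T), NonOverlapping I → ∑ i ∈ I, ρ i.1 i.2 ^ (p / 2) ≤ W₃)
    (hΓ : ∀ I : Finset (Time T × Time T), NonOverlapping I → ‖∑ i ∈ I, Γ i.1 i.2‖ ≤
      C₁ * √(∑ i ∈ I, dist (f i.1) (f i.2) ^ 2 * x i.1 i.2 ^ 2)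
        + C₂ * ∑ i ∈ I, dist (f i.1) (f i.2) * ρ i.1 i.2) :
    ∃ (g : Time T → Time T → ℝ) (W : ℝ), IsJumpGerm hT f Γ J g (p / 2) W := by
  let g₀ : Time T → Time T → ℝ := fun u v => dist (f u) (f v) ^ p + x u v ^ p + ρ u v ^ (p / 2)
  have hd : ∀ u v, 0 ≤ dist (f u) (f v) := fun _ _ => dist_nonneg
  have hg₀ : ∀ u v, 0 ≤ g₀ u v := fun u v => by
    have := hd u v
    have := hx u v
    have := hρ u v
    positivity
  set W := W₁ + W₂ + W₃
  have hgW : ∀ I : Finset (Time T × Time T), NonOverlapping I → ∑ i ∈ I, g₀ i.1 i.2 ≤ W := by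
    intro I hI
    simp only [g₀, Finset.sum_add_distrib]
    linarith [hW₁ I hI, hW₂ I hI, hW₃ I hI]
  have hW : 0 ≤ W := by simpa using hgW ∅ NonOverlapping.empty
  -- The basic bound, `c` bounding the increments of `f` and `e ^ p` the total mass.
  have main : ∀ (I : Finset (Time T × Time T)) (c e : ℝ), NonOverlapping I → 0 ≤ c → 0 ≤ e →
      (∀ i ∈ I, dist (f i.1) (f i.2) ≤ c) → ∑ i ∈ I, g₀ i.1 i.2 ≤ e ^ p →
      ‖∑ i ∈ I, Γ i.1 i.2‖ ≤ C₁ * √(c ^ (2 - p / 2) * e ^ (2 - p / 2) * e ^ p)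
        + C₂ * (c ^ (1 - p / 3) * e ^ (2 - 2 * p / 3) * e ^ p) := by
    intro I c e hI hc he hac hge
    have hi : ∀ i ∈ I, g₀ i.1 i.2 ≤ e ^ p := fun i hi =>
      (Finset.single_le_sum (f := fun i : Time T × Time T => g₀ i.1 i.2)
        (fun j _ => hg₀ j.1 j.2) hi).trans hge
    have hxe : ∀ i ∈ I, x i.1 i.2 ≤ e := fun i hiI => by
      refine (Real.rpow_le_rpow_iff (hx _ _) he hp).1 (le_trans ?_ (hi i hiI))
      have := Real.rpow_nonneg (hd i.1 i.2) p
      have := Real.rpow_nonneg (hρ i.1 i.2) (p / 2)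
      simp only [g₀]
      linarith
    have hρe : ∀ i ∈ I, ρ i.1 i.2 ≤ e ^ 2 := fun i hiI => by
      refine (Real.rpow_le_rpow_iff (hρ _ _) (by positivity) (half_pos hp)).1 ?_
      rw [← Real.rpow_natCast e, ← Real.rpow_mul he,
        show ((2 : ℕ) : ℝ) * (p / 2) = p by push_cast; ring]
      refine le_trans ?_ (hi i hiI)
      have := Real.rpow_nonneg (hd i.1 i.2) p
      have := Real.rpow_nonneg (hx i.1 i.2) p
      simp only [g₀]
      linarith
    have h1 := sum_sq_mul_sq_le (I := I) hp (by linarith) (fun i _ => hd i.1 i.2)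
      (fun i _ => hx i.1 i.2) hac hxe
    have h2 := sum_mul_le (I := I) hp hp3 he (fun i _ => hd i.1 i.2)
      (fun i _ => hρ i.1 i.2) hac hρe
    have h3 : ∑ i ∈ I, (dist (f i.1) (f i.2) ^ p + x i.1 i.2 ^ p) ≤ e ^ p :=
      (Finset.sum_le_sum fun i _ => by
        have := Real.rpow_nonneg (hρ i.1 i.2) (p / 2)
        simp only [g₀]
        linarith).trans hge
    have h4 : ∑ i ∈ I, (dist (f i.1) (f i.2) ^ p + ρ i.1 i.2 ^ (p / 2)) ≤ e ^ p :=
      (Finset.sum_le_sum fun i _ => by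
        have := Real.rpow_nonneg (hx i.1 i.2) p
        simp only [g₀]
        linarith).trans hge
    refine (hΓ I hI).trans (add_le_add (mul_le_mul_of_nonneg_left (Real.sqrt_le_sqrt ?_) hC₁)
      (mul_le_mul_of_nonneg_left ?_ hC₂))
    · exact h1.trans (mul_le_mul_of_nonneg_left h3 (by positivity))
    · exact h2.trans (mul_le_mul_of_nonneg_left h4 (by positivity))
  have hroot : ∀ {w : ℝ}, 0 ≤ w → (w ^ (1 / p)) ^ p = w := fun hw => by
    rw [← Real.rpow_mul hw, one_div_mul_cancel hp.ne', Real.rpow_one]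
  let E := W ^ (1 / p)
  have hE : 0 ≤ E := Real.rpow_nonneg hW _
  let K := (C₁ + C₂ * E) ^ (p / 2)
  have hK : 0 ≤ K := by positivity
  refine ⟨fun u v => K * g₀ u v, K * W, hcadlag, hzero, htendsto,
    fun u v _ => mul_nonneg hK (hg₀ u v), fun I hI => ?_, fun I hI => ?_, fun ε hε => ?_⟩
  · rw [← Finset.mul_sum]
    exact mul_le_mul_of_nonneg_left (hgW I hI) hK
  · -- Here the increments are bounded by the total mass.
    set w := ∑ i ∈ I, g₀ i.1 i.2
    have hw : 0 ≤ w := Finset.sum_nonneg fun i _ => hg₀ i.1 i.2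
    set e := w ^ (1 / p)
    have he : 0 ≤ e := Real.rpow_nonneg hw _
    have heE : e ≤ E := Real.rpow_le_rpow hw (hgW I hI) (by positivity)
    have hac : ∀ i ∈ I, dist (f i.1) (f i.2) ≤ e := fun i hi => by
      refine (Real.rpow_le_rpow_iff (hd _ _) he hp).1 ?_
      rw [hroot hw]
      refine le_trans ?_ (Finset.single_le_sum (f := fun i : Time T × Time T => g₀ i.1 i.2)
        (fun j _ => hg₀ j.1 j.2) hi)
      have := Real.rpow_nonneg (hx i.1 i.2) p
      have := Real.rpow_nonneg (hρ i.1 i.2) (p / 2)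
      simp only [g₀]
      linarith
    have h1 := main I e e hI he he hac (hroot hw).ge
    have e1 : e ^ (2 - p / 2) * e ^ (2 - p / 2) * e ^ p = (e ^ 2) ^ 2 := by
      rw [← Real.rpow_add' he (by linarith), ← Real.rpow_add' he (by linarith), ← pow_mul,
        ← Real.rpow_natCast]
      congr 1
      push_cast
      ring
    have e2 : e ^ (1 - p / 3) * e ^ (2 - 2 * p / 3) * e ^ p = e * e ^ 2 := by
      rw [← Real.rpow_add' he (by linarith), ← Real.rpow_add' he (by linarith), ← pow_succ',
        ← Real.rpow_natCast]
      congr 1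
      push_cast
      ring
    rw [e1, e2, Real.sqrt_sq (by positivity)] at h1
    have h2 : ‖∑ i ∈ I, Γ i.1 i.2‖ ≤ (C₁ + C₂ * E) * e ^ 2 := by
      refine h1.trans ?_
      have : C₂ * (e * e ^ 2) ≤ C₂ * (E * e ^ 2) := by gcongr
      linarith
    calc ‖∑ i ∈ I, Γ i.1 i.2‖ ^ (p / 2) ≤ ((C₁ + C₂ * E) * e ^ 2) ^ (p / 2) :=
          Real.rpow_le_rpow (norm_nonneg _) h2 (by positivity)
      _ = K * w := by
          rw [Real.mul_rpow (by positivity) (by positivity), ← Real.rpow_natCast e,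
            ← Real.rpow_mul he, show ((2 : ℕ) : ℝ) * (p / 2) = p by push_cast; ring, hroot hw]
      _ = ∑ i ∈ I, K * g₀ i.1 i.2 := Finset.mul_sum _ _ _
  · let φ : ℝ → ℝ := fun c => C₁ * √(c ^ (2 - p / 2) * E ^ (2 - p / 2) * E ^ p)
      + C₂ * (c ^ (1 - p / 3) * E ^ (2 - 2 * p / 3) * E ^ p)
    have hα : 0 < 2 - p / 2 := by linarith
    have hβ : 0 < 1 - p / 3 := by linarith
    have hφc : Continuous φ := by
      have h1 : Continuous fun c : ℝ => c ^ (2 - p / 2) := Real.continuous_rpow_const hα.le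
      have h2 : Continuous fun c : ℝ => c ^ (1 - p / 3) := Real.continuous_rpow_const hβ.le
      fun_prop
    have hφ0 : φ 0 = 0 := by
      simp [φ, Real.zero_rpow hα.ne', Real.zero_rpow hβ.ne']
    have hev : ∀ᶠ c in 𝓝[>] (0 : ℝ), φ c < ε :=
      nhdsWithin_le_nhds (hφc.tendsto 0 (Iio_mem_nhds (by rwa [hφ0])))
    obtain ⟨c, hc, hc0⟩ := (hev.and self_mem_nhdsWithin).exists
    exact ⟨c, hc0, fun I hI hac => (main I c E hI (le_of_lt hc0) hE hac
      ((hgW I hI).trans (hroot hW).ge)).trans hc.le⟩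

/-! ### Processes as paths in `L^q` -/

section Processes

variable {Ω : Type*} {mΩ : MeasurableSpace Ω} {P : Measure Ω} {T : ℝ} {hT : 0 < T}
  {A : Type*} [NormedAddCommGroup A] {p q : ℝ} {Y : Time T → Ω → A}

lemma eLpNorm_le_condNorm [IsProbabilityMeasure P] {ℱ : Filtration (Time T) mΩ} (hq : 0 < q)
    {r : ℝ≥0∞} (hr : 1 ≤ r) (s : Time T) (f : Ω → A) :
    eLpNorm f (ENNReal.ofReal q) P ≤ condNorm P ℱ q r s f := by
  rw [eLpNorm_eq_lintegral_rpow_enorm_toReal (by simpa using hq) ENNReal.ofReal_ne_top,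
    ENNReal.toReal_ofReal hq.le, condNorm]
  refine ENNReal.rpow_le_rpow ?_ (by positivity)
  rw [← lintegral_condLExp (ℱ.le s) P (fun ω => ‖f ω‖ₑ ^ q)]
  calc ∫⁻ ω, P⁻[fun ω => ‖f ω‖ₑ ^ q | ℱ s] ω ∂P
      = eLpNorm P⁻[fun ω => ‖f ω‖ₑ ^ q | ℱ s] 1 P := by
        rw [eLpNorm_one_eq_lintegral_enorm]
        simp
    _ ≤ _ := eLpNorm_le_eLpNorm_of_exponent_le hr
        ((measurable_condLExp' _ _ _).aestronglyMeasurable)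

lemma pVarTotal_mono (hp : 0 ≤ p) {f g : Time T → Time T → ℝ≥0∞} (h : ∀ u v, f u v ≤ g u v) :
    pVarTotal hT p f ≤ pVarTotal hT p g :=
  ENNReal.rpow_le_rpow (iSup_mono fun _ => Finset.sum_le_sum fun _ _ =>
    ENNReal.rpow_le_rpow (h _ _) hp) (by positivity)

lemma RoughStoch.MemVLr.memVL [IsProbabilityMeasure P] {ℱ : Filtration (Time T) mΩ} {r : ℝ≥0∞}
    (h : MemVLr hT P ℱ p q r Y) (hp : 0 ≤ p) (hq : 0 < q) (hr : 1 ≤ r) : MemVL hT P p q Y :=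
  ⟨h.measurable, h.right_cont, h.memLp_zero,
    (pVarTotal_mono hp fun _ _ => eLpNorm_le_condNorm hq hr _ _).trans_lt h.finite⟩

lemma RoughStoch.MemVL.memLp (h : MemVL hT P p q Y) (hp : 0 < p) (t : Time T) :
    MemLp (Y t) (ENNReal.ofReal q) P := by
  rcases eq_or_lt_of_le (show zeroTime hT ≤ t from t.2.1) with h0 | h0
  · exact h0 ▸ h.memLp_zero
  · have h1 : MemLp (fun ω => Y t ω - Y (zeroTime hT) ω) (ENNReal.ofReal q) P :=
      ⟨((h.measurable t).sub (h.measurable _)).aestronglyMeasurable,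
        lt_top_of_pVarTotal hp h.finite h0⟩
    convert h1.add h.memLp_zero using 1
    funext ω
    simp

/-- A process with values in `L^q`, as a path in the space `L^q`. -/
noncomputable def lpPath (hY : ∀ t, MemLp (Y t) (ENNReal.ofReal q) P) (t : Time T) :
    Lp A (ENNReal.ofReal q) P :=
  (hY t).toLp (Y t)

lemma lpPath_sub (hY : ∀ t, MemLp (Y t) (ENNReal.ofReal q) P) (u v : Time T) :
    lpPath hY v - lpPath hY u = ((hY v).sub (hY u)).toLp (fun ω => Y v ω - Y u ω) :=
  rfl

lemma dist_lpPath [Fact (1 ≤ ENNReal.ofReal q)] (hY : ∀ t, MemLp (Y t) (ENNReal.ofReal q) P)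
    (u v : Time T) : dist (lpPath hY u) (lpPath hY v)
      = (eLpNorm (fun ω => Y v ω - Y u ω) (ENNReal.ofReal q) P).toReal := by
  rw [dist_comm, dist_eq_norm, lpPath_sub, Lp.norm_toLp]

lemma exists_sum_dist_lpPath_le [Fact (1 ≤ ENNReal.ofReal q)] (h : MemVL hT P p q Y) (hp : 0 < p)
    (hY : ∀ t, MemLp (Y t) (ENNReal.ofReal q) P) :
    ∃ W : ℝ, ∀ I : Finset (Time T × Time T), NonOverlapping I →
      ∑ i ∈ I, dist (lpPath hY i.1) (lpPath hY i.2) ^ p ≤ W := by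
  obtain ⟨W, -, hW⟩ := exists_sum_rpow_le_of_pVarTotal hp h.finite
  exact ⟨W, fun I hI => by simpa only [dist_lpPath] using hW I hI⟩

/-- Right-continuity in probability improves to right-continuity in `L^q`, because the right limits
in `L^q` exist. -/
lemma isCadlag_lpPath [CompleteSpace A] [Fact (1 ≤ ENNReal.ofReal q)] (h : MemVL hT P p q Y)
    (hp : 0 < p) (hY : ∀ t, MemLp (Y t) (ENNReal.ofReal q) P) : IsCadlag (lpPath hY) := by
  obtain ⟨W, hW⟩ := exists_sum_dist_lpPath_le h hp hY
  refine fun t => ⟨?_, exists_tendsto_nhdsLT hp hW t⟩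
  rw [← continuousWithinAt_Ioi_iff_Ici]
  obtain ⟨l, hl⟩ := exists_tendsto_nhdsGT hp hW t
  rcases (𝓝[>] t).eq_or_neBot with hbot | hne
  · rw [ContinuousWithinAt, hbot]
    exact tendsto_bot
  · have h1 : TendstoInMeasure P Y (𝓝[>] t) l :=
      (tendstoInMeasure_of_tendsto_Lp hl).congr_left fun s => (hY s).coeFn_toLp
    have h2 : l = lpPath hY t := Lp.ext
      ((tendstoInMeasure_ae_unique h1 (h.right_cont t)).trans (hY t).coeFn_toLp.symm)
    rw [ContinuousWithinAt, ← h2]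
    exact hl

lemma exists_isLeftLimit [CompleteSpace A] [Fact (1 ≤ ENNReal.ofReal q)] (h : MemVL hT P p q Y)
    (hp : 0 < p) (t : Time T) : ∃ L, IsLeftLimit P q Y t L := by
  have hY := h.memLp hp
  obtain ⟨l, hl⟩ := (isCadlag_lpPath h hp hY t).2
  refine ⟨l, Lp.memLp l, ((Lp.tendsto_Lp_iff_tendsto_eLpNorm' _ _).1 hl).congr fun s => ?_⟩
  refine eLpNorm_congr_ae ?_
  filter_upwards [(hY s).coeFn_toLp] with ω hω
  simp [lpPath, hω]

lemma isLeftLimit_leftLimit {t : Time T} (h : ∃ L, IsLeftLimit P q Y t L) :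
    IsLeftLimit P q Y t (leftLimit P q Y t) := by
  rw [leftLimit, dif_pos h]
  exact h.choose_spec

lemma memLp_jump (hY : ∀ t, MemLp (Y t) (ENNReal.ofReal q) P) {t : Time T}
    (h : ∃ L, IsLeftLimit P q Y t L) : MemLp (jump P q Y t) (ENNReal.ofReal q) P :=
  (hY t).sub (isLeftLimit_leftLimit h).1

/-- The increments over intervals shrinking to `t` from both sides converge to the jump at `t`. -/
lemma tendsto_lpPath_sub [CompleteSpace A] [Fact (1 ≤ ENNReal.ofReal q)] (h : MemVL hT P p q Y)
    (hp : 0 < p) (hY : ∀ t, MemLp (Y t) (ENNReal.ofReal q) P) (t : Time T)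
    (hj : MemLp (jump P q Y t) (ENNReal.ofReal q) P) :
    Tendsto (fun i : Time T × Time T => lpPath hY i.2 - lpPath hY i.1) (𝓝[<] t ×ˢ 𝓝[≥] t)
      (𝓝 (hj.toLp _)) := by
  have hL := isLeftLimit_leftLimit (exists_isLeftLimit h hp t)
  have h1 : Tendsto (lpPath hY) (𝓝[<] t) (𝓝 (hL.1.toLp _)) :=
    (Lp.tendsto_Lp_iff_tendsto_eLpNorm'' _ hY _ hL.1).2 hL.2
  have h2 : Tendsto (lpPath hY) (𝓝[≥] t) (𝓝 (lpPath hY t)) := (isCadlag_lpPath h hp hY t).1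
  exact (h2.comp tendsto_snd).sub (h1.comp tendsto_fst)

end Processes

/-! ### The bracket germ of a martingale and a controlled path -/

section BracketGerm

variable {Ω : Type*} {mΩ : MeasurableSpace Ω} {P : Measure Ω} {T : ℝ} {hT : 0 < T}
  {ℱ : Filtration (Time T) mΩ} {d : ℕ}
  {E : Type*} [NormedAddCommGroup E] [NormedSpace ℝ E]
  {F : Type*} [NormedAddCommGroup F] [NormedSpace ℝ F]
  {G : Type*} [NormedAddCommGroup G] [NormedSpace ℝ G]
  {p q : ℝ} {r : ℝ≥0∞}

lemma one_le_ofReal {q : ℝ} (hq : 1 ≤ q) : 1 ≤ ENNReal.ofReal q := by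
  rw [← ENNReal.ofReal_one]
  exact ENNReal.ofReal_le_ofReal hq

lemma holderTriple_ofReal {q : ℝ} (hq : 0 < q) :
    ENNReal.HolderTriple (ENNReal.ofReal q) (ENNReal.ofReal q) (ENNReal.ofReal (q / 2)) := by
  refine ⟨?_⟩
  rw [← ENNReal.ofReal_inv_of_pos hq, ← ENNReal.ofReal_inv_of_pos (by positivity),
    ← ENNReal.ofReal_add (by positivity) (by positivity)]
  congr 1
  field_simp
  norm_num

lemma holder_toLp {Q R : ℝ≥0∞} [ENNReal.HolderTriple Q Q R] (β : E →L[ℝ] F →L[ℝ] G) {f : Ω → E}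
    {g : Ω → F} (hf : MemLp f Q P) (hg : MemLp g Q P) :
    β.holder R (hf.toLp f) (hg.toLp g)
      = (β.memLp_of_bilin R hf hg).toLp (fun ω => β (f ω) (g ω)) := by
  refine MemLp.toLp_congr _ _ ?_
  filter_upwards [hf.coeFn_toLp, hg.coeFn_toLp] with ω h1 h2
  rw [h1, h2]

/-- The part of an increment of a controlled path which is linear in the increment of `X`. -/
def derivIncrement (X : Time T → EuclideanSpace ℝ (Fin d))
    (Z' : Time T → Ω → EuclideanSpace ℝ (Fin d) →L[ℝ] F) (u v : Time T) : Ω → F :=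
  fun ω => Z' u ω (X v - X u)

lemma condExp_bilin_increment_eq_zero [CompleteSpace E] [CompleteSpace F] [CompleteSpace G]
    (β : E →L[ℝ] F →L[ℝ] G) {M : Time T → Ω → E} (hM : Martingale M ℱ P) {u v : Time T}
    (huv : u ≤ v) {f : Ω → F} (hf : StronglyMeasurable[ℱ u] f)
    (hint : Integrable (fun ω => β (M v ω - M u ω) (f ω)) P) :
    P[fun ω => β (M v ω - M u ω) (f ω) | ℱ u] =ᵐ[P] 0 := by
  have h1 := condExp_bilin_of_stronglyMeasurable_right (m := ℱ u) (μ := P) β (f := M v - M u) hf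
    hint ((hM.integrable v).sub (hM.integrable u))
  have h2 := condExp_sub (hM.integrable v) (hM.integrable u) (ℱ u)
  have h3 := hM.condExp_ae_eq huv
  have h4 := hM.condExp_ae_eq (le_refl u)
  filter_upwards [h1, h2, h3, h4] with ω h1 h2 h3 h4
  refine h1.trans ?_
  rw [h2, Pi.sub_apply, h3, h4, sub_self]
  simp

variable [IsProbabilityMeasure P] {X : Time T → EuclideanSpace ℝ (Fin d)} {Z : Time T → Ω → F}
  {Z' : Time T → Ω → EuclideanSpace ℝ (Fin d) →L[ℝ] F}

lemma RoughStoch.IsControlled.exists_eLpNorm_deriv_le [CompleteSpace F]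
    (hZ : IsControlled hT P ℱ p q r X Z Z') (hr : 1 ≤ r) :
    ∃ K : ℝ, 0 ≤ K ∧ ∀ u v, MemLp (derivIncrement X Z' u v) (ENNReal.ofReal q) P ∧
      (eLpNorm (derivIncrement X Z' u v) (ENNReal.ofReal q) P).toReal ≤ K * ‖X v - X u‖ := by
  have hle : ∀ u, eLpNorm (Z' u) (ENNReal.ofReal q) P
      ≤ ⨆ s, eLpNorm (Z' s) (ENNReal.ofReal q * r) P := fun u =>
    (eLpNorm_le_eLpNorm_of_exponent_le (le_mul_of_one_le_right' hr)
      (hZ.mem'.measurable u).aestronglyMeasurable).trans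
      (le_iSup (fun s => eLpNorm (Z' s) (ENNReal.ofReal q * r) P) u)
  refine ⟨(⨆ s, eLpNorm (Z' s) (ENNReal.ofReal q * r) P).toReal, ENNReal.toReal_nonneg,
    fun u v => ?_⟩
  have h1 : eLpNorm (derivIncrement X Z' u v) (ENNReal.ofReal q) P
      ≤ ENNReal.ofReal ‖X v - X u‖ * ⨆ s, eLpNorm (Z' s) (ENNReal.ofReal q * r) P :=
    (eLpNorm_le_mul_eLpNorm_of_ae_le_mul (g := Z' u) (c := ‖X v - X u‖)
      (Eventually.of_forall fun ω => ((Z' u ω).le_opNorm _).trans_eq (mul_comm _ _)) _).trans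
      (mul_le_mul_right (hle u) _)
  have h2 := ENNReal.mul_ne_top (ENNReal.ofReal_ne_top (r := ‖X v - X u‖)) hZ.bounded'.ne
  refine ⟨⟨?_, h1.trans_lt h2.lt_top⟩, ?_⟩
  · exact ((ContinuousLinearMap.apply ℝ F (X v - X u)).continuous.comp_stronglyMeasurable
      (hZ.mem'.measurable u)).aestronglyMeasurable
  · have h3 := ENNReal.toReal_mono h2 h1
    rwa [ENNReal.toReal_mul, ENNReal.toReal_ofReal (norm_nonneg _), mul_comm] at h3

variable [FiniteDimensional ℝ G] [CompleteSpace E] [CompleteSpace F] [CompleteSpace G]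
  [Fact (1 ≤ ENNReal.ofReal q)] [Fact (1 ≤ ENNReal.ofReal (q / 2))]
  [ENNReal.HolderTriple (ENNReal.ofReal q) (ENNReal.ofReal q) (ENNReal.ofReal (q / 2))]

/-- Sums of products of increments of a martingale `M` and a controlled path `Z`: the part of `δZ`
which is linear in `δX` contributes martingale differences, the remainder a Young sum. -/
lemma exists_norm_sum_holder_le (β : E →L[ℝ] F →L[ℝ] G) (hq : 4 ≤ q) (hr : 1 ≤ r)
    {M : Time T → Ω → E} (hMmart : Martingale M ℱ P)
    (hM : ∀ t, MemLp (M t) (ENNReal.ofReal q) P) (hZL : ∀ t, MemLp (Z t) (ENNReal.ofReal q) P)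
    (hZ : IsControlled hT P ℱ p q r X Z Z') :
    ∃ C₁ C₂ : ℝ, 0 ≤ C₁ ∧ 0 ≤ C₂ ∧ ∀ I : Finset (Time T × Time T), NonOverlapping I →
      ‖∑ i ∈ I, β.holder (ENNReal.ofReal (q / 2)) (lpPath hM i.2 - lpPath hM i.1)
          (lpPath hZL i.2 - lpPath hZL i.1)‖ ≤
        C₁ * √(∑ i ∈ I, dist (lpPath hM i.1) (lpPath hM i.2) ^ 2 * ‖X i.2 - X i.1‖ ^ 2)
        + C₂ * ∑ i ∈ I, dist (lpPath hM i.1) (lpPath hM i.2) *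
          (eLpNorm (remainder X Z Z' i.1 i.2) (ENNReal.ofReal q) P).toReal := by
  obtain ⟨K, hK, hζ⟩ := hZ.exists_eLpNorm_deriv_le hr
  obtain ⟨C, hC, hmart⟩ := exists_eLpNorm_sum_le (P := P) G ℱ (m := q / 2) (by linarith)
  have hm1 := one_le_ofReal (q := q / 2) (by linarith)
  have hρ : ∀ u v, MemLp (remainder X Z Z' u v) (ENNReal.ofReal q) P := fun u v =>
    ((hZL v).sub (hZL u)).sub (hζ u v).1
  have hδM : ∀ u v, MemLp (fun ω => M v ω - M u ω) (ENNReal.ofReal q) P := fun u v =>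
    (hM v).sub (hM u)
  let N : Time T → Time T → Lp G (ENNReal.ofReal (q / 2)) P := fun u v =>
    β.holder (ENNReal.ofReal (q / 2)) (lpPath hM v - lpPath hM u) ((hζ u v).1.toLp _)
  let R : Time T → Time T → Lp G (ENNReal.ofReal (q / 2)) P := fun u v =>
    β.holder (ENNReal.ofReal (q / 2)) (lpPath hM v - lpPath hM u) ((hρ u v).toLp _)
  have hsplit : ∀ u v, β.holder (ENNReal.ofReal (q / 2)) (lpPath hM v - lpPath hM u)
      (lpPath hZL v - lpPath hZL u) = N u v + R u v := by
    intro u v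
    rw [← ContinuousLinearMap.holder_add_right, ← MemLp.toLp_add, lpPath_sub hZL]
    congr 1
    refine MemLp.toLp_congr _ _ (Eventually.of_forall fun ω => ?_)
    simp [derivIncrement, remainder]
  have hnormM : ∀ u v, ‖lpPath hM v - lpPath hM u‖ = dist (lpPath hM u) (lpPath hM v) :=
    fun u v => by rw [dist_comm, dist_eq_norm]
  have hNle : ∀ u v, ‖N u v‖ ≤ ‖β‖ * K * (dist (lpPath hM u) (lpPath hM v) * ‖X v - X u‖) := by
    intro u v
    have h1 := β.norm_holder_apply_apply_le (r := ENNReal.ofReal (q / 2))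
      (lpPath hM v - lpPath hM u) ((hζ u v).1.toLp _)
    rw [Lp.norm_toLp, hnormM] at h1
    refine h1.trans ((mul_le_mul_of_nonneg_left (hζ u v).2 (by positivity)).trans_eq ?_)
    ring
  refine ⟨C * (‖β‖ * K), ‖β‖, by positivity, by positivity, fun I hI => ?_⟩
  rw [Finset.sum_congr rfl fun i _ => hsplit i.1 i.2, Finset.sum_add_distrib]
  refine (norm_add_le _ _).trans (add_le_add ?_ ?_)
  · let δ : Time T → Time T → Ω → G := fun u v ω =>
      β (M v ω - M u ω) (derivIncrement X Z' u v ω)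
    have hδL : ∀ u v, MemLp (δ u v) (ENNReal.ofReal (q / 2)) P := fun u v =>
      β.memLp_of_bilin _ (hδM u v) (hζ u v).1
    have hN : ∀ u v, N u v = (hδL u v).toLp _ := fun u v => by
      simp only [N]
      rw [lpPath_sub hM, holder_toLp]
    have hζmeas : ∀ u v, StronglyMeasurable[ℱ u] (derivIncrement X Z' u v) := fun u v =>
      (ContinuousLinearMap.apply ℝ F (X v - X u)).continuous.comp_stronglyMeasurable
        (hZ.adapted' u)
    have hmeas : ∀ i ∈ I, StronglyMeasurable[ℱ i.2] (δ i.1 i.2) := fun i hi => by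
      have hle := (hI.lt i hi).le
      have h1 : StronglyMeasurable[ℱ i.2] (fun ω => M i.2 ω - M i.1 ω) :=
        (hMmart.1 i.2).sub ((hMmart.1 i.1).mono (ℱ.mono hle))
      have h2 := (hζmeas i.1 i.2).mono (ℱ.mono hle)
      exact β.continuous₂.comp_stronglyMeasurable (h1.prodMk h2)
    have h1 := hmart δ I hI (fun i _ => hδL i.1 i.2) hmeas fun i hi =>
      condExp_bilin_increment_eq_zero β hMmart (hI.lt i hi).le (hζmeas i.1 i.2)
        ((hδL i.1 i.2).integrable hm1)
    have h2 : ‖∑ i ∈ I, N i.1 i.2‖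
        = (eLpNorm (fun ω => ∑ i ∈ I, δ i.1 i.2 ω) (ENNReal.ofReal (q / 2)) P).toReal := by
      rw [Lp.norm_def]
      congr 1
      refine eLpNorm_congr_ae ?_
      have h3 : ∀ᵐ ω ∂P, ∀ i ∈ I, N i.1 i.2 ω = δ i.1 i.2 ω := by
        refine (Finset.eventually_all I).2 fun i _ => ?_
        rw [hN]
        exact (hδL i.1 i.2).coeFn_toLp
      filter_upwards [Lp.coeFn_finsetSum I (fun i : Time T × Time T => N i.1 i.2), h3]
        with ω h4 h5
      rw [h4, Finset.sum_apply]
      exact Finset.sum_congr rfl h5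
    have h6 : ∑ i ∈ I, (eLpNorm (δ i.1 i.2) (ENNReal.ofReal (q / 2)) P).toReal ^ 2
        ≤ (‖β‖ * K) ^ 2 *
          ∑ i ∈ I, dist (lpPath hM i.1) (lpPath hM i.2) ^ 2 * ‖X i.2 - X i.1‖ ^ 2 := by
      rw [Finset.mul_sum]
      refine Finset.sum_le_sum fun i _ => ?_
      rw [← mul_pow, ← mul_pow]
      refine pow_le_pow_left₀ ENNReal.toReal_nonneg ?_ 2
      have := hNle i.1 i.2
      rwa [hN, Lp.norm_toLp] at this
    rw [h2]
    refine h1.trans ?_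
    rw [mul_assoc]
    refine mul_le_mul_of_nonneg_left ((Real.sqrt_le_sqrt h6).trans_eq ?_) hC
    rw [Real.sqrt_mul (sq_nonneg _), Real.sqrt_sq (by positivity)]
  · refine (norm_sum_le _ _).trans ?_
    rw [Finset.mul_sum]
    refine Finset.sum_le_sum fun i _ => ?_
    have h1 := β.norm_holder_apply_apply_le (r := ENNReal.ofReal (q / 2))
      (lpPath hM i.2 - lpPath hM i.1) ((hρ i.1 i.2).toLp _)
    rwa [Lp.norm_toLp, hnormM, mul_assoc] at h1

open Classical in
/-- The product of the jumps at the time `t`, as an element of `L^{q/2}`; there is no jump at the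
time `0`. -/
noncomputable def jumpLp (hT : 0 < T) (β : E →L[ℝ] F →L[ℝ] G) {M : Time T → Ω → E}
    {Z : Time T → Ω → F} (hjM : ∀ t, MemLp (jump P q M t) (ENNReal.ofReal q) P)
    (hjZ : ∀ t, MemLp (jump P q Z t) (ENNReal.ofReal q) P) (t : Time T) :
    Lp G (ENNReal.ofReal (q / 2)) P :=
  if t = zeroTime hT then 0 else
    β.holder (ENNReal.ofReal (q / 2)) ((hjM t).toLp _) ((hjZ t).toLp _)

lemma exists_isJumpGerm (β : E →L[ℝ] F →L[ℝ] G) (hp : 2 ≤ p) (hp3 : p < 3) (hq : 4 ≤ q)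
    (hr : 1 ≤ r) (hX : MemV hT p X) {M : Time T → Ω → E} (hMmart : Martingale M ℱ P)
    (hMV : MemVL hT P p q M) (hZV : MemVL hT P p q Z) (hZ : IsControlled hT P ℱ p q r X Z Z')
    (hR : pVarTotal hT (p / 2)
      (fun u v => eLpNorm (remainder X Z Z' u v) (ENNReal.ofReal q) P) < ∞)
    (hM : ∀ t, MemLp (M t) (ENNReal.ofReal q) P) (hZL : ∀ t, MemLp (Z t) (ENNReal.ofReal q) P)
    (hjM : ∀ t, MemLp (jump P q M t) (ENNReal.ofReal q) P)
    (hjZ : ∀ t, MemLp (jump P q Z t) (ENNReal.ofReal q) P) :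
    ∃ (g : Time T → Time T → ℝ) (W : ℝ), IsJumpGerm hT (lpPath hM)
      (fun u v => β.holder (ENNReal.ofReal (q / 2)) (lpPath hM v - lpPath hM u)
        (lpPath hZL v - lpPath hZL u)) (jumpLp hT β hjM hjZ) g (p / 2) W := by
  have hp0 : 0 < p := by linarith
  obtain ⟨C₁, C₂, hC₁, hC₂, hbound⟩ :=
    exists_norm_sum_holder_le β hq hr hMmart hM hZL hZ
  obtain ⟨W₁, hW₁⟩ := exists_sum_dist_lpPath_le hMV hp0 hM
  obtain ⟨W₂, -, hW₂⟩ := exists_sum_rpow_le_of_pVarTotal hp0 hX.finite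
  obtain ⟨W₃, -, hW₃⟩ := exists_sum_rpow_le_of_pVarTotal (half_pos hp0) hR
  refine IsJumpGerm.of_norm_sum_le hp0 hp3 (x := fun u v => ‖X v - X u‖)
    (ρ := fun u v => (eLpNorm (remainder X Z Z' u v) (ENNReal.ofReal q) P).toReal)
    (fun _ _ => norm_nonneg _) (fun _ _ => ENNReal.toReal_nonneg) hC₁ hC₂
    (isCadlag_lpPath hMV hp0 hM) (by simp [jumpLp]) ?_ hW₁
    (fun I hI => by simpa using hW₂ I hI) hW₃ hbound
  intro s hs
  rw [jumpLp, if_neg hs.ne']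
  have h1 := tendsto_lpPath_sub hMV hp0 hM s (hjM s)
  have h2 := tendsto_lpPath_sub hZV hp0 hZL s (hjZ s)
  have h3 := ((β.holderL P (ENNReal.ofReal q) (ENNReal.ofReal q)
    (ENNReal.ofReal (q / 2))).continuous₂.tendsto ((hjM s).toLp _, (hjZ s).toLp _)).comp
      (h1.prodMk_nhds h2)
  simpa only [Function.comp_def, ContinuousLinearMap.holderL_apply_apply,
    Function.uncurry_apply_pair] using h3

end BracketGerm

/-! ### From paths in `L^m` back to processes -/

section Versions

variable {Ω : Type*} {mΩ : MeasurableSpace Ω} {P : Measure Ω} {T : ℝ} {hT : 0 < T}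
  {G : Type*} [NormedAddCommGroup G] {m : ℝ}

lemma coeFn_partition_sum {Γ : Time T → Time T → Lp G (ENNReal.ofReal m) P}
    {γ : Time T → Time T → Ω → G} (hΓ : ∀ u v, Γ u v =ᵐ[P] γ u v) {s t : Time T}
    (π : Partition s t) :
    (π.sum Γ : Lp G (ENNReal.ofReal m) P) =ᵐ[P] π.sum γ := by
  rw [π.sum_eq_sum_pairs, π.sum_eq_sum_pairs]
  have h1 : ∀ᵐ ω ∂P, ∀ i ∈ π.pairs, Γ i.1 i.2 ω = γ i.1 i.2 ω :=
    (Finset.eventually_all _).2 fun i _ => hΓ i.1 i.2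
  filter_upwards [Lp.coeFn_finsetSum π.pairs (fun i : Time T × Time T => Γ i.1 i.2), h1]
    with ω h2 h3
  rw [h2, Finset.sum_apply, Finset.sum_apply]
  exact Finset.sum_congr rfl h3

variable [Fact (1 ≤ ENNReal.ofReal m)]

/-- Limits in `L^m` of `ℱ_t`-measurable partition sums have `ℱ_t`-measurable versions. -/
lemma aestronglyMeasurable_of_partition [NormedSpace ℝ G] [CompleteSpace G]
    {ℱ : Filtration (Time T) mΩ}
    {Γ : Time T → Time T → Lp G (ENNReal.ofReal m) P} {t : Time T}
    (hΓ : ∀ u v, u ≤ v → AEStronglyMeasurable[ℱ v] (Γ u v) P) {b : Lp G (ENNReal.ofReal m) P}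
    (hb : ∀ ε > 0, ∃ η : ℝ, 0 < η ∧ ∀ π : Partition (zeroTime hT) t, π.MeshLT η →
      ‖b - π.sum Γ‖ < ε) :
    AEStronglyMeasurable[ℱ t] b P := by
  have hclosed := isClosed_aestronglyMeasurable (F := G) (p := ENNReal.ofReal m) (μ := P) (ℱ.le t)
  refine hclosed.closure_subset (Metric.mem_closure_iff.2 fun ε hε => ?_)
  obtain ⟨η, hη, h⟩ := hb ε hε
  obtain ⟨π, hπ⟩ := Partition.exists_meshLT hT t hη
  refine ⟨π.sum Γ, ?_, by rw [dist_eq_norm]; exact h π hπ⟩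
  change AEStronglyMeasurable[ℱ t] (π.sum Γ : Lp G (ENNReal.ofReal m) P) P
  rw [← mem_lpMeas_iff_aestronglyMeasurable (𝕜 := ℝ), π.sum_eq_sum_pairs]
  refine Submodule.sum_mem _ fun i hi => mem_lpMeas_iff_aestronglyMeasurable.2 ?_
  exact (hΓ i.1 i.2 (π.nonOverlapping_pairs.lt i hi).le).mono
    (ℱ.mono (Partition.bounds_of_mem_pairs hi).2)

lemma memVL_of_ae_eq {κ W : ℝ} (hκ : 0 < κ) {b : Time T → Lp G (ENNReal.ofReal m) P}
    {B : Time T → Ω → G} (hB : ∀ t, StronglyMeasurable (B t)) (hBb : ∀ t, B t =ᵐ[P] b t)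
    (hcont : ∀ t, Tendsto b (𝓝[>] t) (𝓝 (b t)))
    (hvar : ∀ I : Finset (Time T × Time T), NonOverlapping I →
      ∑ i ∈ I, ‖b i.2 - b i.1‖ ^ κ ≤ W) : MemVL hT P κ m B := by
  refine ⟨hB, fun t => ?_, (memLp_congr_ae (hBb _)).2 (Lp.memLp _), ?_⟩
  · exact (tendstoInMeasure_of_tendsto_Lp (hcont t)).congr (fun s => (hBb s).symm) (hBb t).symm
  · have hnorm : ∀ u v, eLpNorm (fun ω => B v ω - B u ω) (ENNReal.ofReal m) P ^ κ
        = ENNReal.ofReal (‖b v - b u‖ ^ κ) := by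
      intro u v
      rw [← ENNReal.ofReal_rpow_of_nonneg (norm_nonneg _) hκ.le, ofReal_norm, Lp.enorm_def]
      congr 1
      refine eLpNorm_congr_ae ?_
      filter_upwards [hBb u, hBb v, Lp.coeFn_sub (b v) (b u)] with ω h1 h2 h3
      rw [h1, h2, h3, Pi.sub_apply]
    rw [pVarTotal, pVar]
    refine ENNReal.rpow_lt_top_of_nonneg (by positivity) (ne_top_of_le_ne_top
      (ENNReal.ofReal_ne_top (r := W)) (iSup_le fun π => ?_))
    rw [π.sum_eq_sum_pairs]
    simp only [hnorm]
    rw [← ENNReal.ofReal_sum_of_nonneg fun _ _ => by positivity]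
    exact ENNReal.ofReal_le_ofReal (hvar _ π.nonOverlapping_pairs)

lemma eLpNorm_sub_eq {b s : Lp G (ENNReal.ofReal m) P} {f g : Ω → G} (hf : f =ᵐ[P] b)
    (hg : s =ᵐ[P] g) : eLpNorm (f - g) (ENNReal.ofReal m) P = ENNReal.ofReal ‖b - s‖ := by
  rw [ofReal_norm, Lp.enorm_def]
  refine eLpNorm_congr_ae ?_
  filter_upwards [hf, hg, Lp.coeFn_sub b s] with ω h1 h2 h3
  rw [Pi.sub_apply, h1, ← h2, h3, Pi.sub_apply]

end Versions

theorem lemma5p3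
    {Ω : Type*} {mΩ : MeasurableSpace Ω} (P : Measure Ω) [IsProbabilityMeasure P]
    {T : ℝ} (hT : 0 < T) (ℱ : Filtration (Time T) mΩ)
    {d : ℕ}
    {E : Type*} [NormedAddCommGroup E] [NormedSpace ℝ E] [FiniteDimensional ℝ E] [CompleteSpace E]
    {F : Type*} [NormedAddCommGroup F] [NormedSpace ℝ F] [FiniteDimensional ℝ F] [CompleteSpace F]
    {G : Type*} [NormedAddCommGroup G] [NormedSpace ℝ G] (Φ : E ⊗[ℝ] F ≃ₗ[ℝ] G)
    (p q : ℝ) (r : ℝ≥0∞) (hp : 2 ≤ p) (hp' : p < 3) (hq : 4 ≤ q) (hr : 1 ≤ r)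
    (X : Time T → EuclideanSpace ℝ (Fin d))
    (XX : Time T → Time T → EuclideanSpace ℝ (Fin d) ⊗[ℝ] EuclideanSpace ℝ (Fin d))
    (hX : IsCadlagRoughPath hT p X XX)
    (M : Time T → Ω → E) (hM : MemVLr hT P ℱ p q r M) (hMmart : Martingale M ℱ P)
    (hMcadlag : ∀ᵐ ω ∂P, IsCadlag (fun t => M t ω))
    (Z : Time T → Ω → F) (Z' : Time T → Ω → EuclideanSpace ℝ (Fin d) →L[ℝ] F)
    (hZ : IsControlled hT P ℱ p q r X Z Z')
    (hR : pVarTotal hT (p / 2)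
      (fun u v => eLpNorm (remainder X Z Z' u v) (ENNReal.ofReal q) P) < ∞) :
    (∀ s, zeroTime hT < s →
      (∃ L, IsLeftLimit P q M s L) ∧ (∃ L, IsLeftLimit P q Z s L)) ∧
    (∃ B : Time T → Ω → G, IsBracket hT P ℱ p q Φ XX M (fun _ _ => 0) Z Z' B) ∧
    (∀ B : Time T → Ω → G, IsBracket hT P ℱ p q Φ XX M (fun _ _ => 0) Z Z' B →
      ∀ t, IsJumpSum hT P q Φ M Z t (B t)) := by
  have hp0 : 0 < p := by linarith
  have hq0 : 0 < q := by linarith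
  have : Fact (1 ≤ ENNReal.ofReal q) := ⟨one_le_ofReal (by linarith)⟩
  have : Fact (1 ≤ ENNReal.ofReal (q / 2)) := ⟨one_le_ofReal (by linarith)⟩
  have := holderTriple_ofReal hq0
  have : FiniteDimensional ℝ G := Φ.finiteDimensional
  have : CompleteSpace G := FiniteDimensional.complete ℝ G
  let β : E →L[ℝ] F →L[ℝ] G :=
    ((TensorProduct.mk ℝ E F).compr₂ Φ.toLinearMap).toContinuousBilinearMap
  have hβ : ∀ x y, β x y = Φ (x ⊗ₜ[ℝ] y) := fun _ _ => rfl
  have hMV := hM.memVL hp0.le hq0 hr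
  have hZV := hZ.mem.memVL hp0.le hq0 hr
  have hML := hMV.memLp hp0
  have hZL := hZV.memLp hp0
  have hlM := exists_isLeftLimit hMV hp0
  have hlZ := exists_isLeftLimit hZV hp0
  have hjM := fun t => memLp_jump hML (hlM t)
  have hjZ := fun t => memLp_jump hZL (hlZ t)
  obtain ⟨g, W, h⟩ := exists_isJumpGerm β hp hp' hq hr hX.memV hMmart hMV hZV hZ hR hML hZL hjM hjZ
  set Γ : Time T → Time T → Lp G (ENNReal.ofReal (q / 2)) P := fun u v =>
    β.holder (ENNReal.ofReal (q / 2)) (lpPath hML v - lpPath hML u) (lpPath hZL v - lpPath hZL u)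
    with hΓdef
  set J : Time T → Lp G (ENNReal.ofReal (q / 2)) P := jumpLp hT β hjM hjZ with hJdef
  have hΓ : ∀ u v, Γ u v =ᵐ[P] bracketGerm Φ XX M (fun _ _ => 0) Z Z' u v := by
    intro u v
    simp only [hΓdef]
    rw [lpPath_sub hML, lpPath_sub hZL, holder_toLp]
    refine (MemLp.coeFn_toLp _).trans (Eventually.of_forall fun ω => ?_)
    -- The Gubinelli derivative of `M` vanishes, and so does the compensator.
    simp [bracketGerm, hβ, TensorProduct.map_zero_left, TensorProduct.sub_tmul]
  have hJ : ∀ t, zeroTime hT < t → J t =ᵐ[P] jumpTensor P q Φ M Z t := by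
    intro t ht
    rw [hJdef, jumpLp, if_neg ht.ne', holder_toLp]
    exact MemLp.coeFn_toLp _
  have hlim := fun t => fun ε (hε : (0 : ℝ) < ε) => h.exists_meshLT t hε
  refine ⟨fun s _ => ⟨hlM s, hlZ s⟩, ?_, fun B hB t => ?_⟩
  · have hmeas : ∀ u v, u ≤ v → AEStronglyMeasurable[ℱ v] (Γ u v) P := by
      intro u v huv
      have h1 : StronglyMeasurable[ℱ v] (fun ω => M v ω - M u ω) :=
        (hMmart.1 v).sub ((hMmart.1 u).mono (ℱ.mono huv))
      have h2 : StronglyMeasurable[ℱ v] (fun ω => Z v ω - Z u ω) :=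
        (hZ.adapted v).sub ((hZ.adapted u).mono (ℱ.mono huv))
      refine ⟨_, β.continuous₂.comp_stronglyMeasurable (h1.prodMk h2), ?_⟩
      simp only [hΓdef]
      rw [lpPath_sub hML, lpPath_sub hZL, holder_toLp]
      exact MemLp.coeFn_toLp _
    choose B hBmeas hbB using fun t => aestronglyMeasurable_of_partition hmeas (hlim t)
    have hBb := fun t => (hbB t).symm
    refine ⟨B, hBmeas, memVL_of_ae_eq (half_pos hp0) (fun t => (hBmeas t).mono (ℱ.le t)) hBb
      h.tendsto_jumpSum_nhdsGT fun I hI => h.sum_norm_jumpSum_sub_le (half_pos hp0) hI,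
      fun t ε hε => ?_⟩
    obtain ⟨η, hη, hπ⟩ := hlim t ε hε
    refine ⟨η, hη, fun π hmesh => ?_⟩
    rw [eLpNorm_sub_eq (hBb t) (coeFn_partition_sum hΓ π)]
    exact (ENNReal.ofReal_lt_ofReal_iff hε).2 (hπ π hmesh)
  · have hBL := hB.mem.memLp (half_pos hp0) t
    -- Both `B t` and the sum of the jumps are limits of the same partition sums.
    have hBb : hBL.toLp (B t) = IsJumpGerm.jumpSum J t := by
      refine eq_of_forall_dist_le fun ε hε => ?_
      obtain ⟨η₁, hη₁, h₁⟩ := hB.limit t (ε / 2) (half_pos hε)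
      obtain ⟨η₂, hη₂, h₂⟩ := hlim t (ε / 2) (half_pos hε)
      obtain ⟨π, hπ⟩ := Partition.exists_meshLT hT t (lt_min hη₁ hη₂)
      have h3 := h₁ π fun i => (hπ i).trans_le (min_le_left _ _)
      have h4 := h₂ π fun i => (hπ i).trans_le (min_le_right _ _)
      rw [eLpNorm_sub_eq hBL.coeFn_toLp.symm (coeFn_partition_sum hΓ π),
        ENNReal.ofReal_lt_ofReal_iff (half_pos hε), ← dist_eq_norm] at h3
      rw [← dist_eq_norm] at h4
      have := dist_triangle_right (hBL.toLp (B t)) (IsJumpGerm.jumpSum J t) (π.sum Γ)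
      linarith
    have hsupp : Function.support ((Set.Iic t).indicator J) ⊆ jumpTimes hT P q Φ M Z t := by
      intro s hs
      have hst : s ≤ t := Set.mem_of_indicator_ne_zero (s := Set.Iic t) (f := J) hs
      have hs' : J s ≠ 0 := by rwa [Function.mem_support, Set.indicator_of_mem (by exact hst)] at hs
      have hs0 : zeroTime hT < s := lt_of_le_of_ne s.2.1 fun h0 => hs' (by
        rw [← show zeroTime hT = s from h0]
        exact h.zero)
      refine ⟨hs0, hst, fun h0 => hs' ?_⟩
      rw [← eLpNorm_congr_ae (hJ s hs0), ← Lp.enorm_def, enorm_eq_zero] at h0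
      exact h0
    have hsum : HasSum (fun s : jumpTimes hT P q Φ M Z t => J s) (hBL.toLp (B t)) := by
      have h1 := (hasSum_subtype_iff_of_support_subset hsupp).2 (h.hasSum_jumpSum t)
      rw [hBb]
      refine h1.congr_fun fun s => ?_
      exact (Set.indicator_of_mem (show (s : Time T) ∈ Set.Iic t from s.2.2.1) J).symm
    have hnorm : Tendsto (fun S : Finset (jumpTimes hT P q Φ M Z t) =>
        ENNReal.ofReal ‖hBL.toLp (B t) - ∑ s ∈ S, J s‖) atTop (𝓝 0) := by
      have h1 : Tendsto (fun S : Finset (jumpTimes hT P q Φ M Z t) =>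
          ‖hBL.toLp (B t) - ∑ s ∈ S, J s‖) atTop (𝓝 0) := by
        have := (tendsto_const_nhds (x := hBL.toLp (B t))).sub
          (show Tendsto (fun S : Finset (jumpTimes hT P q Φ M Z t) => ∑ s ∈ S, J s) atTop
            (𝓝 (hBL.toLp (B t))) from hsum)
        simpa using this.norm
      simpa using ENNReal.tendsto_ofReal h1
    refine hnorm.congr fun S => (eLpNorm_sub_eq hBL.coeFn_toLp.symm ?_).symm
    have h1 : ∀ᵐ ω ∂P, ∀ s ∈ S, J s ω = jumpTensor P q Φ M Z s ω :=
      (Finset.eventually_all S).2 fun s _ => hJ s s.2.1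
    filter_upwards [Lp.coeFn_finsetSum S (fun s : jumpTimes hT P q Φ M Z t => J s), h1]
      with ω h2 h3
    rw [h2, Finset.sum_apply, Finset.sum_apply]
    exact Finset.sum_congr rfl h3
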